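/- Consider the one-dimensional Klein-Gordon-Zakharov system for real-valued functions $u,n,v$ on $[0,\infty)\times\mathbb{R}$, \[ u_{tt}-u_{xx}+u=-nu,\qquad n_t+v_x=0,\qquad v_t+\left(n+|u|^2\right)_x=0 . \] There exists an absolute constant $\varepsilon>0$ such that the following holds. Let $(u,u_t,n,v)\in C\left([0,\infty),\,H^1(\mathbb{R})\times L^2(\mathbb{R})\times L^2(\mathbb{R})\times L^2(\mathbb{R})\right)$ be a solution of this system, in the sense of distributions, such that $u(t,\cdot)$ is odd for every $t\ge 0$ and \[ \sup_{t\ge 0}\|u(t)\|_{H^1(\mathbb{R})}\le\varepsilon\qquad\text{and}\qquad \sup_{t\ge 0}\|u_t(t)\|_{L^2(\mathbb{R})}\le C \] for some constant $C>0$. Then, for every compact interval $I\subset\mathbb{R}$, \[ \lim_{t\to\infty}\left(\|u(t)\|_{H^1(I)}+\|u_t(t)\|_{L^2(I)}+\|n(t)\|_{L^2(I)}+\|v(t)\|_{L^2(I)}\right)=0 . \] (The energy $\int_{\mathbb{R}} |u|^2+|u_x|^2+|u_t|^2+\tfrac12\left(|n|^2+|v|^2\right)+n|u|^2\,dx$ is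 automatically finite at every time for such functions.) -/

import Mathlib

open MeasureTheory Set Filter Topology
open scoped ContDiff

noncomputable section

/-- The real Hilbert space `L²(ℝ)` of real-valued functions. -/
abbrev L2R : Type := Lp ℝ 2 (volume : Measure ℝ)

/-- Test functions on `ℝ`: smooth with compact support. -/
structure IsTestFunction (ψ : ℝ → ℝ) : Prop where
  smooth : ContDiff ℝ ∞ ψ
  compactSupport : HasCompactSupport ψ

/-- `g` is the weak (distributional) derivative of `f` on `ℝ`. -/
def HasWeakDeriv (f g : L2R) : Prop :=
  ∀ ψ : ℝ → ℝ, IsTestFunction ψ → ∫ x, f x * deriv ψ x = - ∫ x, g x * ψ x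

theorem IsTestFunction.deriv {ψ : ℝ → ℝ} (h : IsTestFunction ψ) : IsTestFunction (deriv ψ) :=
  ⟨((contDiff_infty_iff_deriv (𝕜 := ℝ)).1 h.smooth).2, h.compactSupport.deriv⟩

theorem IsTestFunction.integrable_mul {ψ : ℝ → ℝ} (h : IsTestFunction ψ) (f : L2R) :
    Integrable (fun x => f x * ψ x) :=
  (Lp.memLp f).integrable_mul (q := 2)
    (h.smooth.continuous.memLp_of_hasCompactSupport h.compactSupport)

/-- The Sobolev space `H¹(ℝ)`: pairs `(f, f_x)` of `L²` functions, the second one being the weak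
derivative of the first one (so that it is determined by it), with the norm
`(‖f‖² + ‖f_x‖²)^(1/2)` inherited from the Hilbert sum of two copies of `L²(ℝ)`. -/
def H1R : Submodule ℝ (WithLp 2 (L2R × L2R)) where
  carrier := {p | HasWeakDeriv p.fst p.snd}
  zero_mem' := by
    intro ψ _
    have h0 : ((0 : L2R) : ℝ → ℝ) =ᵐ[volume] 0 := Lp.coeFn_zero ℝ 2 volume
    have h1 : ∀ χ : ℝ → ℝ, ∫ x, (0 : L2R) x * χ x = 0 := by
      intro χ
      refine integral_eq_zero_of_ae ?_
      filter_upwards [h0] with x hx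
      simp only [hx, Pi.zero_apply, zero_mul]
    change ∫ x, (0 : L2R) x * deriv ψ x = - ∫ x, (0 : L2R) x * ψ x
    rw [h1, h1, neg_zero]
  add_mem' := by
    intro p q hp hq ψ hψ
    have key : ∀ (f g : L2R) {χ : ℝ → ℝ}, IsTestFunction χ →
        ∫ x, (f + g) x * χ x = (∫ x, f x * χ x) + ∫ x, g x * χ x := by
      intro f g χ hχ
      rw [← integral_add (hχ.integrable_mul f) (hχ.integrable_mul g)]
      refine integral_congr_ae ?_
      filter_upwards [Lp.coeFn_add f g] with x hx
      rw [hx, Pi.add_apply, add_mul]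
    change ∫ x, (p.fst + q.fst) x * deriv ψ x = - ∫ x, (p.snd + q.snd) x * ψ x
    rw [key _ _ hψ.deriv, key _ _ hψ, hp ψ hψ, hq ψ hψ, neg_add]
  smul_mem' := by
    intro c p hp ψ hψ
    have key : ∀ (f : L2R) (χ : ℝ → ℝ), ∫ x, (c • f) x * χ x = c * ∫ x, f x * χ x := by
      intro f χ
      rw [← integral_const_mul]
      refine integral_congr_ae ?_
      filter_upwards [Lp.coeFn_smul c f] with x hx
      rw [hx, Pi.smul_apply, smul_eq_mul, mul_assoc]
    change ∫ x, (c • p.fst) x * deriv ψ x = - ∫ x, (c • p.snd) x * ψ x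
    rw [key, key, hp ψ hψ, mul_neg]

/-- The underlying `L²` function of an element of `H¹(ℝ)`. -/
def l2Val (u : H1R) : L2R := (u : WithLp 2 (L2R × L2R)).fst

/-- The weak derivative `u_x` of an element `u` of `H¹(ℝ)`. -/
def l2Dx (u : H1R) : L2R := (u : WithLp 2 (L2R × L2R)).snd

/-- `(u, w, n, v)`, with `w = u_t`, is a solution of the one-dimensional Klein-Gordon-Zakharov
system
`u_tt - u_xx + u = - n u`, `n_t + v_x = 0`, `v_t + (n + u²)_x = 0` on `[0, ∞) × ℝ`
in the class `C([0, ∞), H¹ × L² × L² × L²)`. The equations hold in the sense of distributions: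
tested against any `ψ ∈ C_c^∞(ℝ)`, for every time `t ≥ 0` (one-sided time derivative at `t = 0`). -/
structure IsKGZSolution (u : ℝ → H1R) (w n v : ℝ → L2R) : Prop where
  continuousOn_u : ContinuousOn u (Ici 0)
  continuousOn_w : ContinuousOn w (Ici 0)
  continuousOn_n : ContinuousOn n (Ici 0)
  continuousOn_v : ContinuousOn v (Ici 0)
  /-- `u_t = w` -/
  eq_u : ∀ ψ : ℝ → ℝ, IsTestFunction ψ → ∀ t : ℝ, 0 ≤ t →
    HasDerivWithinAt (fun s => ∫ x, l2Val (u s) x * ψ x) (∫ x, w t x * ψ x) (Ici 0) t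
  /-- `w_t = u_xx - u - n u` -/
  eq_w : ∀ ψ : ℝ → ℝ, IsTestFunction ψ → ∀ t : ℝ, 0 ≤ t →
    HasDerivWithinAt (fun s => ∫ x, w s x * ψ x)
      ((∫ x, l2Val (u t) x * deriv (deriv ψ) x) - (∫ x, l2Val (u t) x * ψ x)
        - ∫ x, n t x * l2Val (u t) x * ψ x) (Ici 0) t
  /-- `n_t = - v_x` -/
  eq_n : ∀ ψ : ℝ → ℝ, IsTestFunction ψ → ∀ t : ℝ, 0 ≤ t →
    HasDerivWithinAt (fun s => ∫ x, n s x * ψ x) (∫ x, v t x * deriv ψ x) (Ici 0) t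
  /-- `v_t = - (n + u²)_x` -/
  eq_v : ∀ ψ : ℝ → ℝ, IsTestFunction ψ → ∀ t : ℝ, 0 ≤ t →
    HasDerivWithinAt (fun s => ∫ x, v s x * ψ x)
      (∫ x, (n t x + l2Val (u t) x ^ 2) * deriv ψ x) (Ici 0) t

/-- An `L²` function is odd (almost everywhere, as a class of functions). -/
def IsOddL2 (f : L2R) : Prop := ∀ᵐ x : ℝ, f (-x) = - f x

/-- The norm of `L²([a, b])`. -/
def normL2On (a b : ℝ) (f : L2R) : ℝ := Real.sqrt (∫ x in Icc a b, f x ^ 2)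

/-- The norm of `H¹([a, b])`. -/
def normH1On (a b : ℝ) (u : H1R) : ℝ :=
  Real.sqrt (∫ x in Icc a b, (l2Val u x ^ 2 + l2Dx u x ^ 2))

end

/-!
Differentiating the momentum of the solution weighted by `sign x * (1 - exp (-|x|))` and corrected
by `∫ exp (-|x|) u u_t` gives, with a minus sign and up to terms that are small with `u`, the energy
of `n` and `v` localized by `exp (-|x|)` plus a quadratic form in `u`. Since `u` is odd, it vanishes
at the origin, and a weighted Hardy inequality makes this form coercive. The derivative of
`∫ exp (-2|x|) u u_t` then recovers the missing `u_t`, so the energy localized by `exp (-2|x|)` is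
integrable in time. By energy conservation its time derivative is bounded, whence it tends to zero
(a Barbalat argument).

The identities hold for finite energy solutions because Steklov averages `∫ y in 0..1, f (x + h y)`
of a solution are weakly differentiable in `x` and therefore differentiable in time with values in
`L²`; the identities for the averages pass to the limit `h → 0`.
-/

noncomputable section

open scoped NNReal
open SignType (sign)

/-! ### Primitives -/

/-- `P` is locally absolutely continuous and `p` is its almost everywhere derivative. -/
structure IsPrimitive (P p : ℝ → ℝ) : Prop where
  ac : ∀ a b, AbsolutelyContinuousOnInterval P a b
  hasDerivAt : ∀ᵐ x, HasDerivAt P (p x) x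

theorem intervalIntegrable_of_locallyIntegrable {p : ℝ → ℝ} (hp : LocallyIntegrable p) (a b : ℝ) :
    IntervalIntegrable p volume a b :=
  (hp.integrableOn_isCompact isCompact_uIcc).intervalIntegrable

theorem monotone_sign : Monotone fun x : ℝ => (sign x : ℝ) := by
  intro x y hxy
  rcases lt_trichotomy x 0 with hx | rfl | hx <;> rcases lt_trichotomy y 0 with hy | rfl | hy <;>
    simp [*] <;> linarith

theorem abs_sign_le_one (x : ℝ) : |(sign x : ℝ)| ≤ 1 := by
  rcases lt_trichotomy x 0 with hx | rfl | hx <;> simp [*]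

theorem ae_sign_mul_self_eq_one : ∀ᵐ x : ℝ, (sign x : ℝ) * sign x = 1 := by
  filter_upwards [Measure.ae_ne volume (0 : ℝ)] with x hx
  rcases lt_or_gt_of_ne hx with hx | hx <;> simp [hx]

theorem locallyIntegrable_sign_mul {p : ℝ → ℝ} (hp : LocallyIntegrable p) :
    LocallyIntegrable fun x => (sign x : ℝ) * p x := by
  refine hp.mono (monotone_sign.measurable.aestronglyMeasurable.mul hp.aestronglyMeasurable) ?_
  filter_upwards with x
  simpa using mul_le_mul_of_nonneg_right (abs_sign_le_one x) (abs_nonneg (p x))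

namespace IsPrimitive

variable {P p Q q : ℝ → ℝ}

theorem congr (h : IsPrimitive P p) (hq : p =ᵐ[volume] q) : IsPrimitive P q :=
  ⟨h.ac, by filter_upwards [h.hasDerivAt, hq] with x hx hx'; rwa [← hx']⟩

theorem deriv_ae (h : IsPrimitive P p) : deriv P =ᵐ[volume] p := by
  filter_upwards [h.hasDerivAt] with x hx using hx.deriv

theorem integral_eq_sub (h : IsPrimitive P p) (a b : ℝ) : ∫ x in a..b, p x = P b - P a := by
  rw [← (h.ac a b).integral_deriv_eq_sub]
  refine intervalIntegral.integral_congr_ae ?_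
  filter_upwards [h.deriv_ae] with x hx _ using hx.symm

theorem continuous (h : IsPrimitive P p) : Continuous P := by
  refine continuous_iff_continuousAt.2 fun x => ?_
  refine (h.ac (x - 1) (x + 1)).continuousOn.continuousAt ?_
  rw [uIcc_of_le (by linarith)]
  exact Icc_mem_nhds (by linarith) (by linarith)

theorem locallyIntegrable (h : IsPrimitive P p) : LocallyIntegrable p := by
  refine fun x => ⟨Icc (x - 1) (x + 1), Icc_mem_nhds (by linarith) (by linarith), ?_⟩
  rw [← intervalIntegrable_iff_integrableOn_Icc_of_le (by linarith)]
  exact (h.ac _ _).intervalIntegrable_deriv.congr_ae (ae_restrict_of_ae h.deriv_ae)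

theorem sub (h : IsPrimitive P p) (h' : IsPrimitive Q q) :
    IsPrimitive (fun x => P x - Q x) (fun x => p x - q x) :=
  ⟨fun a b => (h.ac a b).fun_sub (h'.ac a b), by
    filter_upwards [h.hasDerivAt, h'.hasDerivAt] with x hx hx' using hx.sub hx'⟩

theorem mul (h : IsPrimitive P p) (h' : IsPrimitive Q q) :
    IsPrimitive (fun x => P x * Q x) (fun x => p x * Q x + P x * q x) :=
  ⟨fun a b => (h.ac a b).fun_mul (h'.ac a b), by
    filter_upwards [h.hasDerivAt, h'.hasDerivAt] with x hx hx' using hx.mul hx'⟩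

theorem const_add_integral (hp : LocallyIntegrable p) (c : ℝ) :
    IsPrimitive (fun x => c + ∫ t in (0 : ℝ)..x, p t) p := by
  constructor
  · intro a b
    have h_const : AbsolutelyContinuousOnInterval (fun _ : ℝ => c) a b :=
      contDiff_const.contDiffOn.absolutelyContinuousOnInterval
    have h_int : AbsolutelyContinuousOnInterval (fun x => ∫ t in (0 : ℝ)..x, p t)
        (min 0 (min a b)) (max 0 (max a b)) :=
      (intervalIntegrable_of_locallyIntegrable hp _ _
        ).absolutelyContinuousOnInterval_intervalIntegral (by simp [uIcc_of_le])
    refine h_const.add (h_int.mono ?_)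
    rw [uIcc_of_le (a := min 0 (min a b)) (by simp)]
    exact Icc_subset_Icc (min_le_right _ _) (le_max_right _ _)
  · filter_upwards [LocallyIntegrable.ae_hasDerivAt_integral hp] with x hx using (hx 0).const_add c

theorem of_integral (hp : LocallyIntegrable p) (h : ∀ x, P x = P 0 + ∫ t in (0 : ℝ)..x, p t) :
    IsPrimitive P p := by
  rw [funext h]
  exact const_add_integral hp (P 0)

theorem of_continuous (hP : Continuous P) (hp : LocallyIntegrable p)
    (h : ∀ x, x ≠ 0 → HasDerivAt P (p x) x) : IsPrimitive P p := by
  refine of_integral hp fun x => ?_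
  rw [integral_eq_of_hasDerivAt_off_countable P p (countable_singleton 0) hP.continuousOn
    (fun y hy => h y hy.2) (intervalIntegrable_of_locallyIntegrable hp _ _)]
  ring

theorem sign_mul (h : IsPrimitive P p) (h0 : P 0 = 0) :
    IsPrimitive (fun x => sign x * P x) (fun x => sign x * p x) := by
  refine of_integral (locallyIntegrable_sign_mul h.locallyIntegrable) fun x => ?_
  suffices ∫ t in (0 : ℝ)..x, (sign t : ℝ) * p t = sign x * ∫ t in (0 : ℝ)..x, p t by
    rw [this, h.integral_eq_sub, h0]; ring
  rw [← intervalIntegral.integral_const_mul]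
  refine intervalIntegral.integral_congr_ae ?_
  filter_upwards [Measure.ae_ne volume (0 : ℝ)] with t ht0 ht
  rcases le_total 0 x with hx | hx
  · rw [uIoc_of_le hx] at ht
    rw [sign_pos ht.1, sign_pos (ht.1.trans_le ht.2)]
  · rw [uIoc_of_ge hx] at ht
    have ht_neg : t < 0 := lt_of_le_of_ne ht.2 ht0
    rw [sign_neg ht_neg, sign_neg (ht.1.trans ht_neg)]

theorem exp_neg_mul_abs (k : ℝ) :
    IsPrimitive (fun x => Real.exp (-(k * |x|)))
      (fun x => -k * (sign x * Real.exp (-(k * |x|)))) := by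
  have h_cont : Continuous fun x : ℝ => Real.exp (-(k * |x|)) := by fun_prop
  refine of_continuous h_cont
    ((locallyIntegrable_sign_mul h_cont.locallyIntegrable).smul (-k)) fun x hx => ?_
  convert! ((hasDerivAt_abs hx).const_mul k).fun_neg.exp using 1
  ring

theorem tendsto_atTop_zero (h : IsPrimitive P p) (hP : Integrable P) (hp : Integrable p) :
    Tendsto P atTop (𝓝 0) := by
  have h_lim : Tendsto P atTop (𝓝 (P 0 + ∫ y in Ioi 0, p y)) := by
    refine ((intervalIntegral_tendsto_integral_Ioi 0 hp.integrableOn tendsto_id).const_add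
      (P 0)).congr fun y => ?_
    simp [h.integral_eq_sub]
  rwa [IntegrableAtFilter.eq_zero_of_tendsto (hP.integrableAtFilter _) (fun s hs => ?_) h_lim]
    at h_lim
  obtain ⟨a, ha⟩ := mem_atTop_sets.1 hs
  exact measure_mono_top ha (Real.volume_Ici (a := a))

theorem tendsto_atBot_zero (h : IsPrimitive P p) (hP : Integrable P) (hp : Integrable p) :
    Tendsto P atBot (𝓝 0) := by
  have h_lim : Tendsto P atBot (𝓝 (P 0 - ∫ y in Iic 0, p y)) := by
    refine ((intervalIntegral_tendsto_integral_Iic 0 hp.integrableOn tendsto_id).const_sub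
      (P 0)).congr fun y => ?_
    simp [h.integral_eq_sub]
  rwa [IntegrableAtFilter.eq_zero_of_tendsto (hP.integrableAtFilter _) (fun s hs => ?_) h_lim]
    at h_lim
  obtain ⟨a, ha⟩ := mem_atBot_sets.1 hs
  exact measure_mono_top ha (Real.volume_Iic (a := a))

theorem eq_integral_Iic (h : IsPrimitive P p) (hP : Integrable P) (hp : Integrable p) (x : ℝ) :
    P x = ∫ y in Iic x, p y := by
  refine tendsto_nhds_unique (f := fun a => P x - P a) (l := atBot) ?_ ?_
  · simpa using (h.tendsto_atBot_zero hP hp).const_sub (P x)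
  · simpa [h.integral_eq_sub] using
      intervalIntegral_tendsto_integral_Iic x hp.integrableOn tendsto_id

theorem integral_eq_zero (h : IsPrimitive P p) (hP : Integrable P) (hp : Integrable p) :
    ∫ x, p x = 0 := by
  refine tendsto_nhds_unique
    (intervalIntegral_tendsto_integral hp tendsto_neg_atTop_atBot tendsto_id) ?_
  simpa [h.integral_eq_sub] using (h.tendsto_atTop_zero hP hp).sub
    ((h.tendsto_atBot_zero hP hp).comp tendsto_neg_atTop_atBot)

end IsPrimitive

/-! ### Test functions and weak derivatives -/

namespace IsTestFunction

variable {ψ χ : ℝ → ℝ}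

theorem continuous (h : IsTestFunction ψ) : Continuous ψ := h.smooth.continuous

theorem hasDerivAt (h : IsTestFunction ψ) (x : ℝ) : HasDerivAt ψ (_root_.deriv ψ x) x :=
  (h.smooth.differentiable (by simp) x).hasDerivAt

theorem isPrimitive (h : IsTestFunction ψ) : IsPrimitive ψ (_root_.deriv ψ) :=
  IsPrimitive.of_continuous h.continuous h.deriv.continuous.locallyIntegrable fun x _ =>
    h.hasDerivAt x

theorem integrable (h : IsTestFunction ψ) : Integrable ψ :=
  h.continuous.integrable_of_hasCompactSupport h.compactSupport

theorem integrable_locallyIntegrable_mul (h : IsTestFunction ψ) {f : ℝ → ℝ}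
    (hf : LocallyIntegrable f) : Integrable fun x => f x * ψ x := by
  simpa [mul_comm] using
    hf.integrable_smul_left_of_hasCompactSupport h.continuous h.compactSupport

theorem const_mul (h : IsTestFunction ψ) (c : ℝ) : IsTestFunction fun x => c * ψ x :=
  ⟨contDiff_const.mul h.smooth, h.compactSupport.mul_left⟩

theorem sub (h : IsTestFunction ψ) (h' : IsTestFunction χ) :
    IsTestFunction fun x => ψ x - χ x :=
  ⟨h.smooth.sub h'.smooth, h.compactSupport.sub h'.compactSupport⟩

theorem exists_forall_le_abs_eq_zero (h : IsTestFunction ψ) :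
    ∃ R : ℝ, ∀ x, R ≤ |x| → ψ x = 0 := by
  obtain ⟨R, hR⟩ := h.compactSupport.isBounded.subset_ball 0
  refine ⟨R, fun x hx => image_eq_zero_of_notMem_tsupport fun hx' => ?_⟩
  exact hx.not_gt (by simpa using hR hx')

theorem contDiff_integral (h : IsTestFunction ψ) (a : ℝ) :
    ContDiff ℝ ∞ fun x => ∫ t in a..x, ψ t := by
  have h_deriv : ∀ x, HasDerivAt (fun x => ∫ t in a..x, ψ t) (ψ x) x := fun x =>
    (h.continuous.integral_hasStrictDerivAt a x).hasDerivAt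
  rw [contDiff_infty_iff_deriv]
  refine ⟨fun x => (h_deriv x).differentiableAt, ?_⟩
  rw [funext fun x => (h_deriv x).deriv]
  exact h.smooth

theorem exists_deriv_eq (h : IsTestFunction ψ) (h0 : ∫ x, ψ x = 0) :
    ∃ χ, IsTestFunction χ ∧ _root_.deriv χ = ψ := by
  obtain ⟨R, hψ⟩ := h.exists_forall_le_abs_eq_zero
  refine ⟨fun x => ∫ t in (-R)..x, ψ t, ⟨h.contDiff_integral _,
    HasCompactSupport.intro (isCompact_closedBall (0 : ℝ) R) fun x hx => ?_⟩,
    funext fun x => (h.continuous.integral_hasStrictDerivAt _ x).hasDerivAt.deriv⟩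
  rw [mem_closedBall_zero_iff, Real.norm_eq_abs, not_le] at hx
  rcases lt_abs.1 hx with hx | hx
  · rw [← h0]
    refine intervalIntegral.integral_eq_integral_of_support_subset fun y hy => ?_
    have hy_abs : |y| < R := not_le.1 fun hy' => hy (hψ y hy')
    exact ⟨(abs_lt.1 hy_abs).1, (abs_lt.1 hy_abs).2.le.trans hx.le⟩
  · refine (intervalIntegral.integral_congr fun y hy => ?_).trans intervalIntegral.integral_zero
    rw [uIcc_of_ge (by linarith)] at hy
    exact hψ y (le_abs.2 (Or.inr (by linarith [hy.2])))

end IsTestFunction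

theorem exists_isTestFunction_integral_eq_one : ∃ ψ, IsTestFunction ψ ∧ ∫ x, ψ x = 1 := by
  let f : ContDiffBump (0 : ℝ) := ⟨1, 2, by norm_num, by norm_num⟩
  exact ⟨f.normed volume, ⟨f.contDiff_normed, f.hasCompactSupport_normed⟩, f.integral_normed⟩

/-- The lemma of du Bois-Reymond. -/
theorem ae_eq_const_of_integral_mul_deriv_eq_zero {f : ℝ → ℝ} (hf : LocallyIntegrable f)
    (h : ∀ ψ, IsTestFunction ψ → ∫ x, f x * deriv ψ x = 0) : ∃ c, f =ᵐ[volume] fun _ => c := by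
  obtain ⟨η, hη, hη_one⟩ := exists_isTestFunction_integral_eq_one
  refine ⟨∫ x, f x * η x, ae_eq_of_integral_contDiff_smul_eq hf (locallyIntegrable_const _)
    fun χ hχ_smooth hχ_supp => ?_⟩
  have hχ : IsTestFunction χ := ⟨hχ_smooth, hχ_supp⟩
  -- Subtracting a multiple of `η` makes the integral of `χ` vanish without changing the pairing.
  obtain ⟨ψ, hψ, h_deriv⟩ := (hχ.sub (hη.const_mul (∫ x, χ x))).exists_deriv_eq (by
    rw [integral_sub hχ.integrable (hη.integrable.const_mul _), integral_const_mul, hη_one]; ring)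
  have h_zero := h ψ hψ
  simp only [h_deriv, mul_sub, mul_left_comm (f _)] at h_zero
  rw [integral_sub (hχ.integrable_locallyIntegrable_mul hf)
    ((hη.integrable_locallyIntegrable_mul hf).const_mul _), integral_const_mul] at h_zero
  simp only [smul_eq_mul, mul_comm (χ _), integral_const_mul]
  linarith

theorem L2R.locallyIntegrable (f : L2R) : LocallyIntegrable f :=
  (Lp.memLp f).locallyIntegrable (by norm_num)

theorem L2R.integrable_mul (f g : L2R) : Integrable fun x => f x * g x :=
  (Lp.memLp f).integrable_mul (q := 2) (Lp.memLp g)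

theorem L2R.inner_eq_integral (f g : L2R) : inner ℝ f g = ∫ x, f x * g x := by
  rw [L2.inner_def]
  simp [mul_comm]

theorem L2R.ext_test {f g : L2R}
    (h : ∀ ψ, IsTestFunction ψ → ∫ x, f x * ψ x = ∫ x, g x * ψ x) : f = g := by
  refine Lp.ext (ae_eq_of_integral_contDiff_smul_eq f.locallyIntegrable g.locallyIntegrable
    fun ψ hψ_smooth hψ_supp => ?_)
  simpa only [smul_eq_mul, mul_comm] using h ψ ⟨hψ_smooth, hψ_supp⟩

/-- A test function, as an element of `L²(ℝ)`. -/
def IsTestFunction.toL2 {ψ : ℝ → ℝ} (h : IsTestFunction ψ) : L2R :=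
  (h.continuous.memLp_of_hasCompactSupport h.compactSupport).toLp ψ

theorem IsTestFunction.inner_toL2 {ψ : ℝ → ℝ} (h : IsTestFunction ψ) (f : L2R) :
    inner ℝ h.toL2 f = ∫ x, f x * ψ x := by
  rw [L2R.inner_eq_integral]
  refine integral_congr_ae ?_
  filter_upwards [MemLp.coeFn_toLp (h.continuous.memLp_of_hasCompactSupport h.compactSupport)]
    with x hx
  rw [IsTestFunction.toL2, hx, mul_comm]

theorem IsPrimitive.integral_mul_deriv {P p ψ : ℝ → ℝ} (h : IsPrimitive P p)
    (hψ : IsTestFunction ψ) : ∫ x, P x * deriv ψ x = - ∫ x, p x * ψ x := by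
  have hP := h.continuous.locallyIntegrable (μ := volume)
  have i₁ := hψ.integrable_locallyIntegrable_mul h.locallyIntegrable
  have i₂ := hψ.deriv.integrable_locallyIntegrable_mul hP
  have h_zero := (h.mul hψ.isPrimitive).integral_eq_zero
    (hψ.integrable_locallyIntegrable_mul hP) (i₁.add i₂)
  rw [integral_add i₁ i₂] at h_zero
  linarith

theorem IsPrimitive.hasWeakDeriv {P p : ℝ → ℝ} {f g : L2R} (h : IsPrimitive P p)
    (hf : f =ᵐ[volume] P) (hg : g =ᵐ[volume] p) : HasWeakDeriv f g := by
  intro ψ hψ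
  rw [← (h.congr hg.symm).integral_mul_deriv hψ]
  refine integral_congr_ae ?_
  filter_upwards [hf] with x hx
  rw [hx]

theorem HasWeakDeriv.exists_isPrimitive {f g : L2R} (h : HasWeakDeriv f g) :
    ∃ P, IsPrimitive P g ∧ f =ᵐ[volume] P := by
  have h_prim := IsPrimitive.const_add_integral g.locallyIntegrable
  have h_loc := (h_prim 0).continuous.locallyIntegrable (μ := volume)
  obtain ⟨c, hc⟩ := ae_eq_const_of_integral_mul_deriv_eq_zero
    (f.locallyIntegrable.sub h_loc) fun ψ hψ => by
      simp only [Pi.sub_apply, sub_mul]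
      rw [integral_sub (hψ.deriv.integrable_mul f)
        (hψ.deriv.integrable_locallyIntegrable_mul h_loc), h ψ hψ,
        (h_prim 0).integral_mul_deriv hψ, sub_self]
  refine ⟨_, h_prim c, ?_⟩
  filter_upwards [hc] with x hx
  simp only [Pi.sub_apply, zero_add] at hx
  linarith

/-! ### Steklov averages -/

/-- Translation `f ↦ f (· + y)` on `L²(ℝ)`. -/
def translateL2 (y : ℝ) : L2R →L[ℝ] L2R :=
  (Lp.compMeasurePreservingₗᵢ ℝ (fun x : ℝ => x + y)
    (measurePreserving_add_right volume y)).toContinuousLinearMap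

theorem coeFn_translateL2 (y : ℝ) (f : L2R) : translateL2 y f =ᵐ[volume] fun x => f (x + y) :=
  Lp.coeFn_compMeasurePreserving f (measurePreserving_add_right volume y)

theorem translateL2_zero (f : L2R) : translateL2 0 f = f := by
  refine Lp.ext ?_
  filter_upwards [coeFn_translateL2 0 f] with x hx
  simp [hx]

theorem continuous_translateL2 : Continuous fun p : ℝ × L2R => translateL2 p.1 p.2 := by
  let shift : C(ℝ, C(ℝ, ℝ)) := (ContinuousMap.mk (fun a : ℝ × ℝ => a.2 + a.1)).curry
  exact continuous_snd.compMeasurePreservingLp (shift.continuous.comp continuous_fst)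
    (fun p => measurePreserving_add_right volume p.1) ENNReal.ofNat_ne_top

theorem integral_translateL2_mul (y : ℝ) (f : L2R) (ψ : ℝ → ℝ) :
    ∫ x, translateL2 y f x * ψ x = ∫ x, f x * ψ (x - y) := by
  rw [← integral_add_right_eq_self (fun x => f x * ψ (x - y)) y]
  refine integral_congr_ae ?_
  filter_upwards [coeFn_translateL2 y f] with x hx
  simp [hx]

theorem IsTestFunction.comp_sub_const {ψ : ℝ → ℝ} (h : IsTestFunction ψ) (y : ℝ) :
    IsTestFunction fun x => ψ (x - y) :=
  ⟨h.smooth.comp (contDiff_id.sub contDiff_const),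
    h.compactSupport.comp_homeomorph (Homeomorph.subRight y)⟩

theorem IsTestFunction.hasDerivAt_integral_translateL2_mul {ψ : ℝ → ℝ} (hψ : IsTestFunction ψ)
    (f : L2R) (y : ℝ) :
    HasDerivAt (fun y => ∫ x, translateL2 y f x * ψ x) (-∫ x, translateL2 y f x * _root_.deriv ψ x)
      y := by
  -- The pairing is the convolution of `f` with the reflection of `ψ`.
  have h_conv := (hψ.compactSupport.comp_homeomorph (Homeomorph.neg ℝ)).hasDerivAt_convolution_right
    (ContinuousLinearMap.mul ℝ ℝ) f.locallyIntegrable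
    ((hψ.smooth.comp contDiff_neg).of_le (by simp)) y
  simp only [integral_translateL2_mul, ← integral_neg]
  convert! h_conv using 1
  · ext z
    simp [convolution]
  · simp only [convolution, Function.comp_def, Homeomorph.coe_neg]
    simp [deriv_comp_neg]

/-- The average `x ↦ ∫ y in 0..1, f (x + h y)` of an `L²` function. Steklov averages turn weak
derivatives into difference quotients, see `HasWeakDeriv.steklov_eq`. -/
def steklov (h : ℝ) : L2R →L[ℝ] L2R :=
  AddMonoidHom.toRealLinearMap
    (AddMonoidHom.mk' (fun f => ∫ y in (0 : ℝ)..1, translateL2 (h * y) f) fun f g => by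
      have h_int (f : L2R) : IntervalIntegrable (fun y => translateL2 (h * y) f) volume 0 1 :=
        (continuous_translateL2.comp₂ (continuous_const_mul h) continuous_const).intervalIntegrable
          _ _
      simp [intervalIntegral.integral_add (h_int f) (h_int g)])
    (intervalIntegral.continuous_parametric_intervalIntegral_of_continuous'
      (continuous_translateL2.comp₂ (by fun_prop) continuous_fst) 0 1)

/-- The difference quotient with step `h`. -/
def diffQuot (h : ℝ) : L2R →L[ℝ] L2R := h⁻¹ • (translateL2 h - ContinuousLinearMap.id ℝ L2R)

theorem steklov_apply (h : ℝ) (f : L2R) :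
    steklov h f = ∫ y in (0 : ℝ)..1, translateL2 (h * y) f := rfl

theorem steklov_zero (f : L2R) : steklov 0 f = f := by
  simp [steklov_apply, translateL2_zero]

theorem continuous_steklov : Continuous fun p : ℝ × L2R => steklov p.1 p.2 :=
  intervalIntegral.continuous_parametric_intervalIntegral_of_continuous'
    (f := fun (p : ℝ × L2R) y => translateL2 (p.1 * y) p.2)
    (continuous_translateL2.comp₂ (by fun_prop) (by fun_prop)) 0 1

theorem integral_steklov_mul (h : ℝ) (f : L2R) {ψ : ℝ → ℝ} (hψ : IsTestFunction ψ) :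
    ∫ x, steklov h f x * ψ x = ∫ y in (0 : ℝ)..1, ∫ x, translateL2 (h * y) f x * ψ x := by
  have h_cont : Continuous fun y => translateL2 (h * y) f :=
    continuous_translateL2.comp₂ (by fun_prop) continuous_const
  simp only [← hψ.inner_toL2, steklov_apply, ← innerSL_apply_apply ℝ hψ.toL2]
  exact (ContinuousLinearMap.intervalIntegral_comp_comm _ (h_cont.intervalIntegrable _ _)).symm

theorem hasWeakDeriv_steklov {h : ℝ} (hh : h ≠ 0) (f : L2R) :
    HasWeakDeriv (steklov h f) (diffQuot h f) := fun ψ hψ =>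
  calc ∫ x, steklov h f x * deriv ψ x
      = ∫ y in (0 : ℝ)..1, ∫ x, translateL2 (h * y) f x * deriv ψ x :=
        integral_steklov_mul h f hψ.deriv
    _ = h⁻¹ • ∫ y in (0 : ℝ)..h, ∫ x, translateL2 y f x * deriv ψ x := by
        simp [intervalIntegral.integral_comp_mul_left
          (fun y => ∫ x, translateL2 y f x * deriv ψ x) hh]
    _ = -(h⁻¹ * ((∫ x, translateL2 h f x * ψ x) - ∫ x, f x * ψ x)) := by
        rw [intervalIntegral.integral_eq_sub_of_hasDerivAt
          (f := fun y => -∫ x, translateL2 y f x * ψ x) (fun y _ => by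
            simpa using (hψ.hasDerivAt_integral_translateL2_mul f y).fun_neg)]
        · simp only [translateL2_zero, smul_eq_mul]; ring
        · simp only [← hψ.deriv.inner_toL2]
          exact (continuous_const.inner
            (continuous_translateL2.comp₂ continuous_id continuous_const)).intervalIntegrable _ _
    _ = -∫ x, diffQuot h f x * ψ x := by
        simp only [← hψ.inner_toL2, diffQuot, smul_apply, sub_apply,
          ContinuousLinearMap.id_apply, inner_smul_right, inner_sub_right]

theorem HasWeakDeriv.translateL2 {f g : L2R} (hfg : HasWeakDeriv f g) (y : ℝ) :
    HasWeakDeriv (translateL2 y f) (translateL2 y g) := fun ψ hψ => by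
  simp only [integral_translateL2_mul]
  simpa [deriv_comp_sub_const] using hfg _ (hψ.comp_sub_const y)

theorem HasWeakDeriv.steklov_eq {h : ℝ} (hh : h ≠ 0) {f g : L2R} (hfg : HasWeakDeriv f g) :
    steklov h g = diffQuot h f := L2R.ext_test fun ψ hψ => by
  rw [← neg_inj, ← hasWeakDeriv_steklov hh f ψ hψ, integral_steklov_mul h g hψ,
    integral_steklov_mul h f hψ.deriv, ← intervalIntegral.integral_neg]
  exact intervalIntegral.integral_congr fun y _ => (hfg.translateL2 (h * y) ψ hψ).symm

theorem eq_add_integral_of_hasDerivWithinAt {m r : ℝ → ℝ} (hm : Continuous m) (hr : Continuous r)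
    (h : ∀ t, 0 ≤ t → HasDerivWithinAt m (r t) (Ici 0) t) {t : ℝ} (ht : 0 ≤ t) :
    m t = m 0 + ∫ s in (0 : ℝ)..t, r s := by
  rw [intervalIntegral.integral_eq_sub_of_hasDeriv_right hm.continuousOn (fun s hs => ?_)
    (hr.intervalIntegrable _ _), add_sub_cancel]
  rw [min_eq_left ht] at hs
  exact (h s hs.1.le).mono (Ioi_subset_Ici_self.trans (Ici_subset_Ici.2 hs.1.le))

theorem hasDerivWithinAt_of_eq_add_integral {E : Type*} [NormedAddCommGroup E] [NormedSpace ℝ E]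
    [CompleteSpace E] {m r : ℝ → E} (hr : Continuous r)
    (h : ∀ t, 0 ≤ t → m t = m 0 + ∫ s in (0 : ℝ)..t, r s) {t : ℝ} (ht : 0 ≤ t) :
    HasDerivWithinAt m (r t) (Ici 0) t :=
  ((hr.integral_hasStrictDerivAt 0 t).hasDerivAt.const_add (m 0)).hasDerivWithinAt.congr h (h t ht)

theorem hasDerivWithinAt_of_continuous_family {m r : ℝ → ℝ → ℝ}
    (hm : Continuous fun p : ℝ × ℝ => m p.1 p.2) (hr : Continuous fun p : ℝ × ℝ => r p.1 p.2)
    (h : ∀ a, a ≠ 0 → ∀ t, 0 ≤ t → HasDerivWithinAt (m a) (r a t) (Ici 0) t)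
    {t : ℝ} (ht : 0 ≤ t) : HasDerivWithinAt (m 0) (r 0 t) (Ici 0) t := by
  have hm_snd (a : ℝ) : Continuous (m a) := hm.comp₂ continuous_const continuous_id
  have hm_fst (t : ℝ) : Continuous fun a => m a t := hm.comp₂ continuous_id continuous_const
  have hr_snd (a : ℝ) : Continuous (r a) := hr.comp₂ continuous_const continuous_id
  refine hasDerivWithinAt_of_eq_add_integral (hr_snd 0) (fun t ht => ?_) ht
  -- Both sides of the integrated identity are continuous in `a` and agree for `a ≠ 0`.
  exact congrFun ((hm_fst t).ext_on (dense_compl_singleton 0) ((hm_fst 0).add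
    (intervalIntegral.continuous_parametric_intervalIntegral_of_continuous' hr 0 t))
    fun a ha => eq_add_integral_of_hasDerivWithinAt (hm_snd a) (hr_snd a) (h a ha) ht) 0

section WeakEvolution

variable {X F G : ℝ → L2R}

/-- A continuous distributional solution of `X_t = G - F_x`, integrated in time. -/
theorem hasWeakDeriv_integral_of_test (hX : Continuous X) (hF : Continuous F) (hG : Continuous G)
    (h : ∀ ψ, IsTestFunction ψ → ∀ t, 0 ≤ t →
      HasDerivWithinAt (fun s => ∫ x, X s x * ψ x)
        ((∫ x, F t x * deriv ψ x) + ∫ x, G t x * ψ x) (Ici 0) t) {t : ℝ} (ht : 0 ≤ t) :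
    HasWeakDeriv (∫ s in (0 : ℝ)..t, F s) (X 0 + (∫ s in (0 : ℝ)..t, G s) - X t) := by
  intro ψ hψ
  have h_comm (φ : L2R) {Z : ℝ → L2R} (hZ : Continuous Z) :
      inner ℝ φ (∫ s in (0 : ℝ)..t, Z s) = ∫ s in (0 : ℝ)..t, inner ℝ φ (Z s) :=
    ((innerSL ℝ φ).intervalIntegral_comp_comm (hZ.intervalIntegrable _ _)).symm
  have h_ftc := h ψ hψ
  simp only [← hψ.inner_toL2, ← hψ.deriv.inner_toL2] at h_ftc ⊢
  have h_eq := eq_add_integral_of_hasDerivWithinAt (by fun_prop) (by fun_prop) h_ftc ht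
  rw [intervalIntegral.integral_add (Continuous.intervalIntegrable (by fun_prop) _ _)
    (Continuous.intervalIntegrable (by fun_prop) _ _), ← h_comm _ hF, ← h_comm _ hG] at h_eq
  rw [inner_sub_right, inner_add_right, h_eq]
  ring

theorem hasDerivWithinAt_steklov_of_test (hX : Continuous X) (hF : Continuous F)
    (hG : Continuous G)
    (h : ∀ ψ, IsTestFunction ψ → ∀ t, 0 ≤ t →
      HasDerivWithinAt (fun s => ∫ x, X s x * ψ x)
        ((∫ x, F t x * deriv ψ x) + ∫ x, G t x * ψ x) (Ici 0) t)
    {a : ℝ} (ha : a ≠ 0) {t : ℝ} (ht : 0 ≤ t) :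
    HasDerivWithinAt (fun s => steklov a (X s)) (steklov a (G t) - diffQuot a (F t)) (Ici 0) t := by
  refine hasDerivWithinAt_of_eq_add_integral (r := fun t => steklov a (G t) - diffQuot a (F t))
    (by fun_prop) (fun t ht => ?_) ht
  have h_eq := (hasWeakDeriv_integral_of_test hX hF hG h ht).steklov_eq ha
  rw [map_sub, map_add, ← ContinuousLinearMap.intervalIntegral_comp_comm _
    (hG.intervalIntegrable _ _), ← ContinuousLinearMap.intervalIntegral_comp_comm _
    (hF.intervalIntegrable _ _)] at h_eq
  rw [intervalIntegral.integral_sub (Continuous.intervalIntegrable (by fun_prop) _ _)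
    (Continuous.intervalIntegrable (by fun_prop) _ _), ← h_eq]
  abel

theorem hasDerivWithinAt_of_test (hX : Continuous X) (hG : Continuous G)
    (h : ∀ ψ, IsTestFunction ψ → ∀ t, 0 ≤ t →
      HasDerivWithinAt (fun s => ∫ x, X s x * ψ x) (∫ x, G t x * ψ x) (Ici 0) t)
    {t : ℝ} (ht : 0 ≤ t) : HasDerivWithinAt X (G t) (Ici 0) t := by
  refine hasDerivWithinAt_of_eq_add_integral hG (fun t ht => L2R.ext_test fun ψ hψ => ?_) ht
  have h_ftc := h ψ hψ
  simp only [← hψ.inner_toL2] at h_ftc ⊢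
  rw [inner_add_right, eq_add_integral_of_hasDerivWithinAt (by fun_prop) (by fun_prop) h_ftc ht]
  exact congrArg _ ((innerSL ℝ hψ.toL2).intervalIntegral_comp_comm (hG.intervalIntegrable _ _))

end WeakEvolution

/-! ### Weighted inner products -/

/-- The space `L^∞(ℝ)` of bounded real-valued functions, used for weights and multipliers. -/
abbrev LinftyR : Type := Lp ℝ ⊤ (volume : Measure ℝ)

/-- The multiplication `L^∞(ℝ) × L²(ℝ) → L²(ℝ)`. -/
def mulL : LinftyR →L[ℝ] L2R →L[ℝ] L2R := (ContinuousLinearMap.mul ℝ ℝ).holderL volume ⊤ 2 2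

theorem coeFn_mulL (a : LinftyR) (f : L2R) : mulL a f =ᵐ[volume] fun x => a x * f x :=
  ContinuousLinearMap.coeFn_holder _ a f

theorem norm_mulL_le (a : LinftyR) (f : L2R) : ‖mulL a f‖ ≤ ‖a‖ * ‖f‖ :=
  (ContinuousLinearMap.norm_holder_apply_apply_le _ a f).trans (by simp)

theorem ae_norm_le_norm (a : LinftyR) : ∀ᵐ x, ‖a x‖ ≤ ‖a‖ := by
  filter_upwards [ae_le_eLpNormEssSup (f := a) (μ := volume)] with x hx
  rw [Lp.norm_def, eLpNorm_exponent_top, ← toReal_enorm]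
  exact ENNReal.toReal_mono (by simpa using (Lp.eLpNorm_ne_top a)) hx

theorem mulL_left_comm (a b : LinftyR) (f : L2R) : mulL a (mulL b f) = mulL b (mulL a f) := by
  refine Lp.ext ?_
  filter_upwards [coeFn_mulL a (mulL b f), coeFn_mulL b f, coeFn_mulL b (mulL a f),
    coeFn_mulL a f] with x h₁ h₂ h₃ h₄
  rw [h₁, h₂, h₃, h₄, mul_left_comm]

/-- The bilinear form `(f, g) ↦ ∫ a f g` on `L²(ℝ)` with a bounded weight `a`. -/
def weightedInner (a : LinftyR) : L2R →L[ℝ] L2R →L[ℝ] ℝ :=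
  ((ContinuousLinearMap.mul ℝ ℝ).lpPairing volume 2 2).comp (mulL a)

section WeightedInner

variable (a : LinftyR) (f g : L2R)

theorem weightedInner_eq_inner : weightedInner a f g = inner ℝ (mulL a f) g := by
  rw [L2R.inner_eq_integral, weightedInner, ContinuousLinearMap.comp_apply,
    ContinuousLinearMap.lpPairing_eq_integral]
  rfl

theorem integrable_weight_mul : Integrable fun x => a x * f x * g x := by
  refine ((mulL a f).integrable_mul g).congr ?_
  filter_upwards [coeFn_mulL a f] with x hx
  rw [hx]

theorem weightedInner_apply : weightedInner a f g = ∫ x, a x * f x * g x := by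
  rw [weightedInner_eq_inner, L2R.inner_eq_integral]
  refine integral_congr_ae ?_
  filter_upwards [coeFn_mulL a f] with x hx
  rw [hx]

theorem weightedInner_comm : weightedInner a f g = weightedInner a g f := by
  simp only [weightedInner_apply, mul_right_comm]

theorem weightedInner_mulL_left (b : LinftyR) :
    weightedInner a (mulL b f) g = weightedInner a f (mulL b g) := by
  rw [weightedInner_comm, weightedInner_apply, weightedInner_apply]
  refine integral_congr_ae ?_
  filter_upwards [coeFn_mulL b f, coeFn_mulL b g] with x hf hg
  rw [hf, hg]
  ring

theorem abs_weightedInner_le : |weightedInner a f g| ≤ ‖a‖ * ‖f‖ * ‖g‖ := by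
  rw [weightedInner_eq_inner]
  exact (abs_real_inner_le_norm _ _).trans (by gcongr; exact norm_mulL_le a f)

variable {a}

theorem weightedInner_self_mono {b : LinftyR} (hab : a ≤ b) :
    weightedInner a f f ≤ weightedInner b f f := by
  rw [weightedInner_apply, weightedInner_apply]
  refine integral_mono_ae (integrable_weight_mul a f f) (integrable_weight_mul b f f) ?_
  filter_upwards [(Lp.coeFn_le a b).2 hab] with x hx
  simpa only [mul_assoc] using mul_le_mul_of_nonneg_right hx (mul_self_nonneg (f x))

theorem weightedInner_self_nonneg (ha : 0 ≤ a) : 0 ≤ weightedInner a f f := by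
  simpa [weightedInner_eq_inner] using weightedInner_self_mono f ha

theorem two_mul_abs_weightedInner_le (ha : 0 ≤ a) :
    2 * |weightedInner a f g| ≤ weightedInner a f f + weightedInner a g g := by
  have h_add := weightedInner_self_nonneg (f + g) ha
  have h_sub := weightedInner_self_nonneg (f - g) ha
  simp only [map_add, map_sub, add_apply, sub_apply, weightedInner_comm a g f] at h_add h_sub
  cases abs_cases (weightedInner a f g) <;> linarith

theorem weightedInner_mulL_self_le (ha : 0 ≤ a) (b : LinftyR) :
    weightedInner a (mulL b f) (mulL b f) ≤ ‖b‖ ^ 2 * weightedInner a f f := by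
  rw [weightedInner_apply, weightedInner_apply, ← integral_const_mul]
  refine integral_mono_ae (integrable_weight_mul a _ _)
    ((integrable_weight_mul a f f).const_mul _) ?_
  filter_upwards [coeFn_mulL b f, ae_norm_le_norm b, (Lp.coeFn_nonneg a).2 ha]
    with x hf hb ha
  have hb_sq : b x ^ 2 ≤ ‖b‖ ^ 2 := sq_le_sq.2 (by rwa [abs_norm])
  calc a x * (mulL b f) x * (mulL b f) x
      = b x ^ 2 * (a x * f x * f x) := by rw [hf]; ring
    _ ≤ ‖b‖ ^ 2 * (a x * f x * f x) :=
        mul_le_mul_of_nonneg_right hb_sq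
          (by rw [mul_assoc]; exact mul_nonneg ha (mul_self_nonneg _))

end WeightedInner

/-- The bounded weight `a` is Lipschitz with derivative `b`. -/
def HasWeightDeriv (a b : LinftyR) : Prop := ∃ A, IsPrimitive A b ∧ a =ᵐ[volume] A

theorem HasWeightDeriv.weightedInner_add {a b : LinftyR} (hab : HasWeightDeriv a b)
    {f f' g g' : L2R} (hf : HasWeakDeriv f f') (hg : HasWeakDeriv g g') :
    weightedInner a f g' + weightedInner a f' g + weightedInner b f g = 0 := by
  obtain ⟨A, hA, hA_ae⟩ := hab
  obtain ⟨P, hP, hP_ae⟩ := hf.exists_isPrimitive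
  obtain ⟨Q, hQ, hQ_ae⟩ := hg.exists_isPrimitive
  have i₁ := integrable_weight_mul a f g'
  have i₂ := integrable_weight_mul a f' g
  have i₃ := integrable_weight_mul b f g
  have h_prod : (fun x => a x * f x * g x) =ᵐ[volume] fun x => A x * P x * Q x := by
    filter_upwards [hA_ae, hP_ae, hQ_ae] with x h₁ h₂ h₃
    rw [h₁, h₂, h₃]
  have h_deriv : (fun x => a x * f x * g' x + a x * f' x * g x + b x * f x * g x) =ᵐ[volume]
      fun x => (b x * P x + A x * f' x) * Q x + A x * P x * g' x := by
    filter_upwards [hA_ae, hP_ae, hQ_ae] with x h₁ h₂ h₃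
    rw [h₁, h₂, h₃]
    ring
  simp only [weightedInner_apply]
  rw [← integral_add i₁ i₂,
    ← integral_add (f := fun x => a x * f x * g' x + a x * f' x * g x) (i₁.add i₂) i₃,
    ← ((hA.mul hP).mul hQ).integral_eq_zero ((integrable_weight_mul a f g).congr h_prod)
      (((i₁.add i₂).add i₃).congr h_deriv)]
  exact integral_congr_ae h_deriv

theorem HasWeightDeriv.two_mul_weightedInner {a b : LinftyR} (hab : HasWeightDeriv a b)
    {f f' : L2R} (hf : HasWeakDeriv f f') :
    2 * weightedInner a f f' = -weightedInner b f f := by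
  have h_ibp := hab.weightedInner_add hf hf
  rw [weightedInner_comm a f' f] at h_ibp
  linarith

/-! ### The space `H¹` -/

/-- The value of an element of `H¹(ℝ)`, as a continuous linear map. -/
def valL : H1R →L[ℝ] L2R := (WithLp.fstL 2 ℝ L2R L2R).comp H1R.subtypeL

/-- The derivative of an element of `H¹(ℝ)`, as a continuous linear map. -/
def dxL : H1R →L[ℝ] L2R := (WithLp.sndL 2 ℝ L2R L2R).comp H1R.subtypeL

theorem hasWeakDeriv_valL (u : H1R) : HasWeakDeriv (valL u) (dxL u) := u.2

theorem H1R.norm_sq_eq (u : H1R) : ‖u‖ ^ 2 = ‖valL u‖ ^ 2 + ‖dxL u‖ ^ 2 :=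
  WithLp.prod_norm_sq_eq_of_L2 (u : WithLp 2 (L2R × L2R))

theorem norm_valL_le (u : H1R) : ‖valL u‖ ≤ ‖u‖ :=
  (sq_le_sq₀ (norm_nonneg _) (norm_nonneg _)).1 (by nlinarith [H1R.norm_sq_eq u])

theorem norm_dxL_le (u : H1R) : ‖dxL u‖ ≤ ‖u‖ :=
  (sq_le_sq₀ (norm_nonneg _) (norm_nonneg _)).1 (by nlinarith [H1R.norm_sq_eq u])

theorem IsPrimitive.sq_le_integral {P p : ℝ → ℝ} (h : IsPrimitive P p)
    (hP : Integrable fun x => P x * P x) (hp : Integrable fun x => p x * p x)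
    (hPp : Integrable fun x => p x * P x) (x : ℝ) :
    P x ^ 2 ≤ (∫ y, P y * P y) + ∫ y, p y * p y := by
  have h_deriv : Integrable fun y => p y * P y + P y * p y :=
    hPp.add (by simpa only [mul_comm] using hPp)
  calc P x ^ 2 = ∫ y in Iic x, (p y * P y + P y * p y) := by
        rw [← (h.mul h).eq_integral_Iic hP h_deriv, sq]
    _ ≤ ∫ y in Iic x, (P y * P y + p y * p y) :=
        setIntegral_mono h_deriv.integrableOn (hP.add hp).integrableOn fun y => by
          linarith [mul_self_nonneg (P y - p y)]
    _ ≤ ∫ y, (P y * P y + p y * p y) :=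
        setIntegral_le_integral (hP.add hp)
          (ae_of_all _ fun y => add_nonneg (mul_self_nonneg _) (mul_self_nonneg _))
    _ = (∫ y, P y * P y) + ∫ y, p y * p y := integral_add hP hp

theorem ae_norm_valL_le (u : H1R) : ∀ᵐ x, ‖valL u x‖ ≤ ‖u‖ := by
  obtain ⟨P, hP, hP_ae⟩ := (hasWeakDeriv_valL u).exists_isPrimitive
  have h_sq : (fun x => valL u x * valL u x) =ᵐ[volume] fun x => P x * P x := hP_ae.mul hP_ae
  have h_mul : (fun x => dxL u x * valL u x) =ᵐ[volume] fun x => dxL u x * P x :=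
    (EventuallyEq.refl _ _).mul hP_ae
  filter_upwards [hP_ae] with x hx
  have h_le := hP.sq_le_integral (((valL u).integrable_mul (valL u)).congr h_sq)
    ((dxL u).integrable_mul (dxL u)) (((dxL u).integrable_mul (valL u)).congr h_mul) x
  rw [← integral_congr_ae h_sq, ← L2R.inner_eq_integral, ← L2R.inner_eq_integral,
    real_inner_self_eq_norm_sq, real_inner_self_eq_norm_sq, ← H1R.norm_sq_eq] at h_le
  rw [hx]
  exact abs_le_of_sq_le_sq h_le (norm_nonneg _)

theorem memLp_top_valL (u : H1R) : MemLp (valL u) ⊤ volume :=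
  memLp_top_of_bound (Lp.aestronglyMeasurable _) _ (ae_norm_valL_le u)

/-- The Sobolev embedding `H¹(ℝ) ⊂ L^∞(ℝ)`. -/
def supL : H1R →L[ℝ] LinftyR :=
  LinearMap.mkContinuous
    { toFun := fun u => (memLp_top_valL u).toLp _
      map_add' := fun u u' => by
        rw [← MemLp.toLp_add]
        refine MemLp.toLp_congr _ _ ?_
        rw [map_add]
        exact Lp.coeFn_add _ _
      map_smul' := fun c u => by
        rw [RingHom.id_apply, ← MemLp.toLp_const_smul]
        refine MemLp.toLp_congr _ _ ?_
        rw [map_smul]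
        exact Lp.coeFn_smul _ _ } 1 fun u => by
    rw [one_mul]
    refine (Lp.norm_toLp _ (memLp_top_valL u)).trans_le
      (ENNReal.toReal_le_of_le_ofReal (norm_nonneg _) ?_)
    rw [eLpNorm_exponent_top]
    exact eLpNormEssSup_le_of_ae_bound (ae_norm_valL_le u)

theorem coeFn_supL (u : H1R) : supL u =ᵐ[volume] valL u := MemLp.coeFn_toLp (memLp_top_valL u)

theorem norm_supL_le (u : H1R) : ‖supL u‖ ≤ ‖u‖ := by
  simpa using supL.le_of_opNorm_le (LinearMap.mkContinuous_norm_le _ zero_le_one _) u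

theorem mulL_supL_valL_comm (u u' : H1R) : mulL (supL u) (valL u') = mulL (supL u') (valL u) := by
  refine Lp.ext ?_
  filter_upwards [coeFn_mulL (supL u) (valL u'), coeFn_mulL (supL u') (valL u), coeFn_supL u,
    coeFn_supL u'] with x h₁ h₂ h₃ h₄
  rw [h₁, h₂, h₃, h₄, mul_comm]

/-- The square of an element of `H¹(ℝ)`, as an element of `L²(ℝ)`. -/
def sqH1 (u : H1R) : L2R := mulL (supL u) (valL u)

@[fun_prop]
theorem continuous_sqH1 : Continuous sqH1 := by unfold sqH1; fun_prop

theorem coeFn_sqH1 (u : H1R) : sqH1 u =ᵐ[volume] fun x => valL u x ^ 2 := by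
  filter_upwards [coeFn_mulL (supL u) (valL u), coeFn_supL u] with x h₁ h₂
  rw [sqH1, h₁, h₂, sq]

/-- The weak derivative `2 u u_x` of `u²`. -/
def sqDx (u : H1R) : L2R := (2 : ℝ) • mulL (supL u) (dxL u)

@[fun_prop]
theorem continuous_sqDx : Continuous sqDx := by unfold sqDx; fun_prop

theorem hasWeakDeriv_sqH1 (u : H1R) : HasWeakDeriv (sqH1 u) (sqDx u) := by
  obtain ⟨P, hP, hP_ae⟩ := (hasWeakDeriv_valL u).exists_isPrimitive
  refine (hP.mul hP).hasWeakDeriv ?_ ?_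
  · filter_upwards [coeFn_sqH1 u, hP_ae] with x h₁ h₂
    rw [h₁, h₂, sq]
  · filter_upwards [coeFn_mulL (supL u) (dxL u), coeFn_supL u, hP_ae,
      Lp.coeFn_smul (2 : ℝ) (mulL (supL u) (dxL u))] with x h₁ h₂ h₃ h₄
    rw [sqDx, h₄, Pi.smul_apply, h₁, h₂, h₃, smul_eq_mul]
    ring

theorem hasDerivWithinAt_sqH1 {u : ℝ → H1R} {u' : L2R} {s : Set ℝ} {t : ℝ}
    (hu : ContinuousWithinAt u s t) (h : HasDerivWithinAt (fun τ => valL (u τ)) u' s t) :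
    HasDerivWithinAt (fun τ => sqH1 (u τ)) ((2 : ℝ) • mulL (supL (u t)) u') s t := by
  have h_sub (τ : ℝ) : mulL (supL (u τ + u t)) (valL (u τ) - valL (u t)) =
      sqH1 (u τ) - sqH1 (u t) := by
    simp only [sqH1, map_add, map_sub, add_apply, mulL_supL_valL_comm (u t) (u τ)]
    abel
  have h_mulL : Tendsto (fun τ => mulL (supL (u τ + u t))) (𝓝[s \ {t}] t)
      (𝓝 (mulL (supL (u t + u t)))) :=
    ((by fun_prop : Continuous fun p : H1R => mulL (supL (p + u t))).tendsto (u t)).comp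
      (hu.mono sdiff_subset)
  have h_lim := (isBoundedBilinearMap_apply.continuous.tendsto (mulL (supL (u t + u t)), u')).comp
    (h_mulL.prodMk_nhds (hasDerivWithinAt_iff_tendsto_slope.1 h))
  rw [hasDerivWithinAt_iff_tendsto_slope]
  convert! h_lim using 2
  · ext1 τ
    rw [Function.comp_apply, slope_def_module, slope_def_module, map_smul, h_sub]
  · rw [map_add, map_add, add_apply, two_smul]

/-! ### Exponential weights -/

theorem memLp_top_expWeight (k : ℝ≥0) : MemLp (fun x : ℝ => Real.exp (-(k * |x|))) ⊤ volume :=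
  memLp_top_of_bound (by fun_prop) 1 (ae_of_all _ fun x => by
    rw [Real.norm_eq_abs, Real.abs_exp, Real.exp_le_one_iff, neg_nonpos]
    positivity)

/-- The weight `x ↦ exp (-k |x|)`. -/
def expWeight (k : ℝ≥0) : LinftyR := (memLp_top_expWeight k).toLp _

theorem coeFn_expWeight (k : ℝ≥0) :
    expWeight k =ᵐ[volume] fun x => Real.exp (-(k * |x|)) := MemLp.coeFn_toLp _

theorem memLp_top_sign : MemLp (fun x : ℝ => (sign x : ℝ)) ⊤ volume :=
  memLp_top_of_bound monotone_sign.measurable.aestronglyMeasurable 1 (ae_of_all _ abs_sign_le_one)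

/-- The sign function, as a multiplier. -/
def signWeight : LinftyR := memLp_top_sign.toLp _

theorem coeFn_signWeight : signWeight =ᵐ[volume] fun x => (sign x : ℝ) := MemLp.coeFn_toLp _

/-- The derivative of the weight `exp (-k |x|)`. -/
def dexpWeight (k : ℝ≥0) : LinftyR := (-k : ℝ) • (signWeight • expWeight k : LinftyR)

theorem coeFn_dexpWeight (k : ℝ≥0) :
    dexpWeight k =ᵐ[volume] fun x => -k * (sign x * Real.exp (-(k * |x|))) := by
  filter_upwards [Lp.coeFn_smul (-k : ℝ) (signWeight • expWeight k : LinftyR),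
    Lp.coeFn_lpSMul signWeight (expWeight k) (r := ⊤), coeFn_signWeight, coeFn_expWeight k]
    with x h₁ h₂ h₃ h₄
  rw [dexpWeight, h₁, Pi.smul_apply, h₂, Pi.smul_apply', h₃, h₄, smul_eq_mul, smul_eq_mul]

theorem hasWeightDeriv_expWeight (k : ℝ≥0) : HasWeightDeriv (expWeight k) (dexpWeight k) :=
  ⟨_, (IsPrimitive.exp_neg_mul_abs k).congr (coeFn_dexpWeight k).symm, coeFn_expWeight k⟩

theorem expWeight_nonneg (k : ℝ≥0) : 0 ≤ expWeight k := by
  rw [← Lp.coeFn_nonneg]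
  filter_upwards [coeFn_expWeight k] with x hx
  rw [hx]
  positivity

theorem expWeight_anti {k l : ℝ≥0} (hkl : k ≤ l) : expWeight l ≤ expWeight k := by
  rw [← Lp.coeFn_le]
  filter_upwards [coeFn_expWeight k, coeFn_expWeight l] with x h₁ h₂
  rw [h₁, h₂]
  gcongr

theorem dexpWeight_zero : dexpWeight 0 = 0 := by simp [dexpWeight]

theorem weightedInner_expWeight_zero (f g : L2R) :
    weightedInner (expWeight 0) f g = inner ℝ f g := by
  rw [weightedInner_apply, L2R.inner_eq_integral]
  refine integral_congr_ae ?_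
  filter_upwards [coeFn_expWeight 0] with x hx
  simp [hx]

theorem weightedInner_smul (a b : LinftyR) (f g : L2R) :
    weightedInner (b • a : LinftyR) f g = weightedInner a (mulL b f) g := by
  rw [weightedInner_apply, weightedInner_apply]
  refine integral_congr_ae ?_
  filter_upwards [Lp.coeFn_lpSMul b a (r := ⊤), coeFn_mulL b f] with x h₁ h₂
  rw [h₁, h₂, Pi.smul_apply', smul_eq_mul]
  ring

theorem weightedInner_dexpWeight (k : ℝ≥0) (f g : L2R) :
    weightedInner (dexpWeight k) f g = -k * weightedInner (expWeight k) (mulL signWeight f) g := by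
  rw [dexpWeight, ← weightedInner_smul, weightedInner_eq_inner, weightedInner_eq_inner, map_smul,
    smul_apply, real_inner_smul_left]

theorem mulL_signWeight_mulL_signWeight (f : L2R) : mulL signWeight (mulL signWeight f) = f := by
  refine Lp.ext ?_
  filter_upwards [coeFn_mulL signWeight (mulL signWeight f), coeFn_mulL signWeight f,
    coeFn_signWeight, ae_sign_mul_self_eq_one] with x h₁ h₂ h₃ h₄
  rw [h₁, h₂, h₃, ← mul_assoc, h₄, one_mul]

theorem weightedInner_mulL_signWeight_self (a : LinftyR) (f : L2R) :
    weightedInner a (mulL signWeight f) (mulL signWeight f) = weightedInner a f f := by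
  rw [weightedInner_mulL_left, mulL_signWeight_mulL_signWeight]

/-- The virial weight `x ↦ sign x * (1 - exp (-|x|))`, an odd primitive of `exp (-|x|)`. -/
def virialWeight : LinftyR := signWeight • (expWeight 0 - expWeight 1)

theorem hasWeightDeriv_virialWeight : HasWeightDeriv virialWeight (expWeight 1) := by
  have h_prim := ((IsPrimitive.exp_neg_mul_abs 0).sub (IsPrimitive.exp_neg_mul_abs 1)).sign_mul
    (by simp)
  refine ⟨_, h_prim.congr ?_, ?_⟩
  · filter_upwards [coeFn_expWeight 1, ae_sign_mul_self_eq_one] with x h₁ h₂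
    simp only [h₁, NNReal.coe_one]
    linear_combination Real.exp (-(1 * |x|)) * h₂
  · filter_upwards [coeFn_expWeight 0, coeFn_expWeight 1, coeFn_signWeight,
      Lp.coeFn_lpSMul signWeight (expWeight 0 - expWeight 1) (r := ⊤),
      Lp.coeFn_sub (expWeight 0) (expWeight 1)] with x h₁ h₂ h₃ h₄ h₅
    rw [virialWeight, h₄, Pi.smul_apply', h₅, Pi.sub_apply, h₁, h₂, h₃, smul_eq_mul,
      NNReal.coe_zero, NNReal.coe_one]

/-! ### Identities for solutions of the system -/

/-- A solution of the Klein-Gordon-Zakharov system for nonnegative times, extended continuously to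
negative times. -/
structure IsContinuousKGZSolution (u : ℝ → H1R) (w n v : ℝ → L2R) : Prop
    extends IsKGZSolution u w n v where
  continuous_u : Continuous u
  continuous_w : Continuous w
  continuous_n : Continuous n
  continuous_v : Continuous v

theorem IsKGZSolution.comp_max_zero {u : ℝ → H1R} {w n v : ℝ → L2R}
    (H : IsKGZSolution u w n v) :
    IsContinuousKGZSolution (fun t => u (max t 0)) (fun t => w (max t 0)) (fun t => n (max t 0))
      (fun t => v (max t 0)) := by
  have h_cont {E : Type} [TopologicalSpace E] {f : ℝ → E} (hf : ContinuousOn f (Ici 0)) :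
      Continuous fun t => f (max t 0) :=
    hf.comp_continuous (by fun_prop) fun t => mem_Ici.2 (le_max_right _ _)
  have h_deriv {m m' : ℝ → ℝ} (h : ∀ t, 0 ≤ t → HasDerivWithinAt m (m' t) (Ici 0) t) (t : ℝ)
      (ht : 0 ≤ t) : HasDerivWithinAt (fun s => m (max s 0)) (m' (max t 0)) (Ici 0) t := by
    rw [max_eq_left ht]
    exact (h t ht).congr (fun s hs => by rw [max_eq_left (mem_Ici.1 hs)]) (by rw [max_eq_left ht])
  exact
    { continuousOn_u := (h_cont H.continuousOn_u).continuousOn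
      continuousOn_w := (h_cont H.continuousOn_w).continuousOn
      continuousOn_n := (h_cont H.continuousOn_n).continuousOn
      continuousOn_v := (h_cont H.continuousOn_v).continuousOn
      eq_u := fun ψ hψ => h_deriv (H.eq_u ψ hψ)
      eq_w := fun ψ hψ => h_deriv (H.eq_w ψ hψ)
      eq_n := fun ψ hψ => h_deriv (H.eq_n ψ hψ)
      eq_v := fun ψ hψ => h_deriv (H.eq_v ψ hψ)
      continuous_u := h_cont H.continuousOn_u
      continuous_w := h_cont H.continuousOn_w
      continuous_n := h_cont H.continuousOn_n
      continuous_v := h_cont H.continuousOn_v }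

@[fun_prop]
theorem continuous_steklov_comp {X : Type*} [TopologicalSpace X] {h : X → ℝ} {f : X → L2R}
    (hh : Continuous h) (hf : Continuous f) : Continuous fun x => steklov (h x) (f x) :=
  continuous_steklov.comp₂ hh hf

theorem hasDerivWithinAt_weightedInner (a : LinftyR) {X Y : ℝ → L2R} {X' Y' : L2R} {s : Set ℝ}
    {t : ℝ} (hX : HasDerivWithinAt X X' s t) (hY : HasDerivWithinAt Y Y' s t) :
    HasDerivWithinAt (fun τ => weightedInner a (X τ) (Y τ))
      (weightedInner a (X t) Y' + weightedInner a X' (Y t)) s t :=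
  (weightedInner a).hasDerivWithinAt_of_bilinear hX hY

/-- The energy of a state, localized by the weight `a`. -/
def weightedEnergy (a : LinftyR) (u : H1R) (w n v : L2R) : ℝ :=
  weightedInner a (valL u) (valL u) + weightedInner a (dxL u) (dxL u) + weightedInner a w w
    + (weightedInner a n n + weightedInner a v v) / 2 + weightedInner a n (sqH1 u)

/-- The momentum of a state, localized by the weight `a`. -/
def weightedMomentum (a : LinftyR) (u : H1R) (w n v : L2R) : ℝ :=
  2 * weightedInner a (dxL u) w - weightedInner a n v

namespace IsContinuousKGZSolution

variable {u : ℝ → H1R} {w n v : ℝ → L2R} (H : IsContinuousKGZSolution u w n v)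
include H

theorem hasDerivWithinAt_val {t : ℝ} (ht : 0 ≤ t) :
    HasDerivWithinAt (fun s => valL (u s)) (w t) (Ici 0) t :=
  hasDerivWithinAt_of_test (valL.continuous.comp H.continuous_u) H.continuous_w H.eq_u ht

theorem hasDerivWithinAt_sq {t : ℝ} (ht : 0 ≤ t) :
    HasDerivWithinAt (fun s => sqH1 (u s)) ((2 : ℝ) • mulL (supL (u t)) (w t)) (Ici 0) t :=
  hasDerivWithinAt_sqH1 H.continuous_u.continuousWithinAt (H.hasDerivWithinAt_val ht)

theorem hasDerivWithinAt_steklov_val (h : ℝ) {t : ℝ} (ht : 0 ≤ t) :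
    HasDerivWithinAt (fun s => steklov h (valL (u s))) (steklov h (w t)) (Ici 0) t :=
  (steklov h).hasFDerivAt.comp_hasDerivWithinAt t (H.hasDerivWithinAt_val ht)

section Steklov

variable {h : ℝ} (hh : h ≠ 0) {t : ℝ} (ht : 0 ≤ t)
include hh ht

theorem hasDerivWithinAt_steklov_dx :
    HasDerivWithinAt (fun s => steklov h (dxL (u s))) (diffQuot h (w t)) (Ici 0) t := by
  simp only [(hasWeakDeriv_valL _).steklov_eq hh]
  exact (diffQuot h).hasFDerivAt.comp_hasDerivWithinAt t (H.hasDerivWithinAt_val ht)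

theorem hasDerivWithinAt_steklov_n :
    HasDerivWithinAt (fun s => steklov h (n s)) (-diffQuot h (v t)) (Ici 0) t := by
  have h_steklov := hasDerivWithinAt_steklov_of_test H.continuous_n H.continuous_v
    (G := 0) continuous_const (fun ψ hψ t ht => ?_) hh ht
  · simpa using h_steklov
  · simpa [← hψ.inner_toL2] using H.eq_n ψ hψ t ht

theorem hasDerivWithinAt_steklov_v :
    HasDerivWithinAt (fun s => steklov h (v s))
      (-diffQuot h (n t) - steklov h (sqDx (u t))) (Ici 0) t := by
  have hu := H.continuous_u
  have h_steklov := hasDerivWithinAt_steklov_of_test (G := 0) (F := fun t => n t + sqH1 (u t))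
    H.continuous_v (H.continuous_n.add (by fun_prop)) continuous_const (fun ψ hψ t ht => ?_) hh ht
  · convert! h_steklov using 1
    rw [(hasWeakDeriv_sqH1 _).steklov_eq hh, map_add, Pi.zero_apply, map_zero]
    abel
  · convert! H.eq_v ψ hψ t ht using 1
    rw [Pi.zero_apply, ← hψ.inner_toL2 0, inner_zero_right, add_zero]
    refine integral_congr_ae ?_
    filter_upwards [Lp.coeFn_add (n t) (sqH1 (u t)), coeFn_sqH1 (u t)] with x h₁ h₂
    rw [h₁, Pi.add_apply, h₂]
    rfl

theorem hasDerivWithinAt_steklov_w :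
    HasDerivWithinAt (fun s => steklov h (w s))
      (diffQuot h (dxL (u t)) - steklov h (valL (u t)) - steklov h (mulL (supL (u t)) (n t)))
      (Ici 0) t := by
  have hu := H.continuous_u
  have hn := H.continuous_n
  have h_steklov := hasDerivWithinAt_steklov_of_test (F := fun t => -dxL (u t))
    (G := fun t => -(valL (u t) + mulL (supL (u t)) (n t)))
    H.continuous_w (by fun_prop) (by fun_prop) (fun ψ hψ t ht => ?_) hh ht
  · convert! h_steklov using 1
    rw [map_neg, map_neg, map_add]
    abel
  · convert! H.eq_w ψ hψ t ht using 1
    have h_mul : ∫ x, n t x * l2Val (u t) x * ψ x = ∫ x, mulL (supL (u t)) (n t) x * ψ x := by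
      refine integral_congr_ae ?_
      filter_upwards [coeFn_mulL (supL (u t)) (n t), coeFn_supL (u t)] with x h₁ h₂
      rw [h₁, h₂, mul_comm (valL (u t) x)]
      rfl
    have h_dx : ∫ x, l2Val (u t) x * deriv (deriv ψ) x = -∫ x, dxL (u t) x * deriv ψ x :=
      hasWeakDeriv_valL (u t) _ hψ.deriv
    have h_val : ∫ x, l2Val (u t) x * ψ x = ∫ x, valL (u t) x * ψ x := rfl
    rw [h_mul, h_dx, h_val]
    simp only [← hψ.inner_toL2, ← hψ.deriv.inner_toL2, inner_neg_right, inner_add_right]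
    ring

end Steklov

variable {a b : LinftyR} (hab : HasWeightDeriv a b) {t : ℝ} (ht : 0 ≤ t)
include hab ht

theorem hasDerivWithinAt_weightedFieldEnergy :
    HasDerivWithinAt (fun s => weightedInner a (valL (u s)) (valL (u s))
        + weightedInner a (dxL (u s)) (dxL (u s)) + weightedInner a (w s) (w s))
      (-2 * weightedInner b (dxL (u t)) (w t)
        - 2 * weightedInner a (n t) (mulL (supL (u t)) (w t))) (Ici 0) t := by
  obtain ⟨-, hu, hw, hn, -⟩ := id H
  let m (h s : ℝ) : ℝ :=
    weightedInner a (steklov h (valL (u s))) (steklov h (valL (u s)))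
      + weightedInner a (steklov h (dxL (u s))) (steklov h (dxL (u s)))
      + weightedInner a (steklov h (w s)) (steklov h (w s))
  let r (h s : ℝ) : ℝ :=
    -2 * weightedInner b (steklov h (dxL (u s))) (steklov h (w s))
      - 2 * weightedInner a (steklov h (w s)) (steklov h (mulL (supL (u s)) (n s)))
  have h_cubic (s : ℝ) : weightedInner a (w s) (mulL (supL (u s)) (n s)) =
      weightedInner a (n s) (mulL (supL (u s)) (w s)) := by
    rw [← weightedInner_mulL_left, weightedInner_comm]
  suffices HasDerivWithinAt (m 0) (r 0 t) (Ici 0) t by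
    simpa only [m, r, steklov_zero, h_cubic] using! this
  refine hasDerivWithinAt_of_continuous_family (by fun_prop) (by fun_prop) (fun h hh t ht => ?_) ht
  have dU := H.hasDerivWithinAt_steklov_val h ht
  have dP := H.hasDerivWithinAt_steklov_dx hh ht
  have dW := H.hasDerivWithinAt_steklov_w hh ht
  convert! ((hasDerivWithinAt_weightedInner a dU dU).add
    (hasDerivWithinAt_weightedInner a dP dP)).add (hasDerivWithinAt_weightedInner a dW dW) using 1
  have h_PW := hab.weightedInner_add (hasWeakDeriv_steklov hh (dxL (u t)))
    (hasWeakDeriv_steklov hh (w t))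
  simp only [r, map_sub, sub_apply, weightedInner_comm a _ (steklov h (w t)),
    weightedInner_comm a (diffQuot h (w t))] at h_PW ⊢
  linarith

theorem hasDerivWithinAt_weightedWaveEnergy :
    HasDerivWithinAt (fun s => (weightedInner a (n s) (n s) + weightedInner a (v s) (v s)) / 2
        + weightedInner a (n s) (sqH1 (u s)))
      (weightedInner b (n t) (v t) + weightedInner b (v t) (sqH1 (u t))
        + 2 * weightedInner a (n t) (mulL (supL (u t)) (w t))) (Ici 0) t := by
  obtain ⟨-, hu, hw, hn, hv⟩ := id H
  let m (h s : ℝ) : ℝ :=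
    (weightedInner a (steklov h (n s)) (steklov h (n s))
        + weightedInner a (steklov h (v s)) (steklov h (v s))) / 2
      + weightedInner a (steklov h (n s)) (sqH1 (u s))
  let r (h s : ℝ) : ℝ :=
    weightedInner b (steklov h (n s)) (steklov h (v s))
      + weightedInner b (steklov h (v s)) (sqH1 (u s))
      + 2 * weightedInner a (steklov h (n s)) (mulL (supL (u s)) (w s))
      + (weightedInner a (steklov h (v s)) (sqDx (u s))
        - weightedInner a (steklov h (v s)) (steklov h (sqDx (u s))))
  suffices HasDerivWithinAt (m 0) (r 0 t) (Ici 0) t by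
    simpa only [m, r, steklov_zero, sub_self, add_zero] using! this
  refine hasDerivWithinAt_of_continuous_family (by fun_prop) (by fun_prop) (fun h hh t ht => ?_) ht
  have dN := H.hasDerivWithinAt_steklov_n hh ht
  have dV := H.hasDerivWithinAt_steklov_v hh ht
  convert! (((hasDerivWithinAt_weightedInner a dN dN).add
    (hasDerivWithinAt_weightedInner a dV dV)).div_const 2).add
    (hasDerivWithinAt_weightedInner a dN (H.hasDerivWithinAt_sq ht)) using 1
  have h_NV := hab.weightedInner_add (hasWeakDeriv_steklov hh (n t))
    (hasWeakDeriv_steklov hh (v t))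
  have h_Vq := hab.weightedInner_add (hasWeakDeriv_steklov hh (v t)) (hasWeakDeriv_sqH1 (u t))
  simp only [r, map_sub, map_neg, map_smul, sub_apply, neg_apply, smul_eq_mul,
    weightedInner_comm a _ (steklov h (v t)), weightedInner_comm a _ (steklov h (n t))]
    at h_NV h_Vq ⊢
  linarith

theorem hasDerivWithinAt_weightedEnergy :
    HasDerivWithinAt (fun s => weightedEnergy a (u s) (w s) (n s) (v s))
      (-2 * weightedInner b (dxL (u t)) (w t) + weightedInner b (n t) (v t)
        + weightedInner b (v t) (sqH1 (u t))) (Ici 0) t := by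
  convert! (H.hasDerivWithinAt_weightedFieldEnergy hab ht).add
    (H.hasDerivWithinAt_weightedWaveEnergy hab ht) using 1
  · ext s
    simp only [weightedEnergy, Pi.add_apply]
    ring
  · ring

theorem hasDerivWithinAt_weightedMomentum :
    HasDerivWithinAt (fun s => weightedMomentum a (u s) (w s) (n s) (v s))
      (weightedInner b (valL (u t)) (valL (u t)) - weightedInner b (dxL (u t)) (dxL (u t))
        - weightedInner b (w t) (w t)
        - (weightedInner b (n t) (n t) + weightedInner b (v t) (v t)) / 2) (Ici 0) t := by
  obtain ⟨-, hu, hw, hn, hv⟩ := id H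
  let m (h s : ℝ) : ℝ :=
    2 * weightedInner a (steklov h (dxL (u s))) (steklov h (w s))
      - weightedInner a (steklov h (n s)) (steklov h (v s))
  let r (h s : ℝ) : ℝ :=
    weightedInner b (steklov h (valL (u s))) (steklov h (valL (u s)))
      - weightedInner b (steklov h (dxL (u s))) (steklov h (dxL (u s)))
      - weightedInner b (steklov h (w s)) (steklov h (w s))
      - (weightedInner b (steklov h (n s)) (steklov h (n s))
        + weightedInner b (steklov h (v s)) (steklov h (v s))) / 2
      + (weightedInner a (steklov h (n s)) (steklov h (sqDx (u s)))
        - 2 * weightedInner a (steklov h (dxL (u s))) (steklov h (mulL (supL (u s)) (n s))))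
  have h_cubic (s : ℝ) : weightedInner a (n s) (sqDx (u s)) =
      2 * weightedInner a (dxL (u s)) (mulL (supL (u s)) (n s)) := by
    rw [← weightedInner_mulL_left, weightedInner_comm, sqDx, map_smul, smul_apply, smul_eq_mul]
  suffices HasDerivWithinAt (m 0) (r 0 t) (Ici 0) t by
    simpa only [m, r, steklov_zero, h_cubic, sub_self, add_zero] using! this
  refine hasDerivWithinAt_of_continuous_family (by fun_prop) (by fun_prop) (fun h hh t ht => ?_) ht
  have dP := H.hasDerivWithinAt_steklov_dx hh ht
  have dW := H.hasDerivWithinAt_steklov_w hh ht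
  have dN := H.hasDerivWithinAt_steklov_n hh ht
  have dV := H.hasDerivWithinAt_steklov_v hh ht
  convert! ((hasDerivWithinAt_weightedInner a dP dW).const_mul 2).sub
    (hasDerivWithinAt_weightedInner a dN dV) using 1
  have h_U := hab.two_mul_weightedInner (hasWeakDeriv_steklov hh (valL (u t)))
  have h_P := hab.two_mul_weightedInner (hasWeakDeriv_steklov hh (dxL (u t)))
  have h_W := hab.two_mul_weightedInner (hasWeakDeriv_steklov hh (w t))
  have h_N := hab.two_mul_weightedInner (hasWeakDeriv_steklov hh (n t))
  have h_V := hab.two_mul_weightedInner (hasWeakDeriv_steklov hh (v t))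
  rw [← (hasWeakDeriv_valL (u t)).steklov_eq hh, weightedInner_comm] at h_U
  simp only [r, map_sub, map_neg, neg_apply, weightedInner_comm a (diffQuot h _)]
  linarith

theorem hasDerivWithinAt_weightedInner_val_w :
    HasDerivWithinAt (fun s => weightedInner a (valL (u s)) (w s))
      (weightedInner a (w t) (w t) - weightedInner a (dxL (u t)) (dxL (u t))
        - weightedInner b (valL (u t)) (dxL (u t)) - weightedInner a (valL (u t)) (valL (u t))
        - weightedInner a (n t) (sqH1 (u t))) (Ici 0) t := by
  obtain ⟨-, hu, hw, hn, -⟩ := id H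
  let m (h s : ℝ) : ℝ := weightedInner a (valL (u s)) (steklov h (w s))
  let r (h s : ℝ) : ℝ :=
    weightedInner a (w s) (steklov h (w s)) - weightedInner a (dxL (u s)) (steklov h (dxL (u s)))
      - weightedInner b (valL (u s)) (steklov h (dxL (u s)))
      - weightedInner a (valL (u s)) (steklov h (valL (u s)))
      - weightedInner a (valL (u s)) (steklov h (mulL (supL (u s)) (n s)))
  have h_cubic (s : ℝ) : weightedInner a (valL (u s)) (mulL (supL (u s)) (n s)) =
      weightedInner a (n s) (sqH1 (u s)) := by
    rw [← weightedInner_mulL_left, weightedInner_comm, sqH1]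
  suffices HasDerivWithinAt (m 0) (r 0 t) (Ici 0) t by
    simpa only [m, r, steklov_zero, h_cubic] using! this
  refine hasDerivWithinAt_of_continuous_family (by fun_prop) (by fun_prop) (fun h hh t ht => ?_) ht
  convert! hasDerivWithinAt_weightedInner a (H.hasDerivWithinAt_val ht)
    (H.hasDerivWithinAt_steklov_w hh ht) using 1
  have h_UP := hab.weightedInner_add (hasWeakDeriv_valL (u t))
    (hasWeakDeriv_steklov hh (dxL (u t)))
  simp only [r, map_sub]
  linarith

end IsContinuousKGZSolution

/-! ### Hardy inequalities with exponential weights -/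

/-- The continuous representative of `f` vanishes at the origin. This is what remains of the oddness
of `u` in the virial estimate. -/
def VanishesAtZero (f : L2R) : Prop := ∃ P : ℝ → ℝ, Continuous P ∧ f =ᵐ[volume] P ∧ P 0 = 0

theorem IsOddL2.vanishesAtZero {f g : L2R} (h : IsOddL2 f) (hfg : HasWeakDeriv f g) :
    VanishesAtZero f := by
  obtain ⟨P, hP, hfP⟩ := hfg.exists_isPrimitive
  have hPc := hP.continuous
  have hfP_neg : ∀ᵐ x : ℝ, f (-x) = P (-x) :=
    (Measure.measurePreserving_neg (volume : Measure ℝ)).quasiMeasurePreserving.ae hfP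
  have h_odd : (fun x => P (-x)) =ᵐ[volume] fun x => -P x := by
    filter_upwards [h, hfP_neg, hfP] with x h₁ h₂ h₃
    rw [← h₂, h₁, h₃]
  have h_odd_zero :=
    congrFun ((Continuous.ae_eq_iff_eq volume (by fun_prop) (by fun_prop)).1 h_odd) 0
  simp only [neg_zero] at h_odd_zero
  exact ⟨P, hPc, hfP, by linarith⟩

theorem vanishesAtZero_sqH1 {u : H1R} (hu : VanishesAtZero (valL u)) :
    VanishesAtZero (sqH1 u) := by
  obtain ⟨P, hP, huP, hP0⟩ := hu
  refine ⟨fun x => P x ^ 2, by fun_prop, ?_, by simp [hP0]⟩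
  filter_upwards [coeFn_sqH1 u, huP] with x h₁ h₂
  rw [h₁, h₂]

namespace HasWeakDeriv

variable {f g : L2R} (hfg : HasWeakDeriv f g) (hf : VanishesAtZero f)
include hfg hf

theorem mulL_signWeight : HasWeakDeriv (mulL signWeight f) (mulL signWeight g) := by
  obtain ⟨P, hP, hfP⟩ := hfg.exists_isPrimitive
  obtain ⟨Q, hQ, hfQ, hQ0⟩ := hf
  obtain rfl : P = Q := (Continuous.ae_eq_iff_eq volume hP.continuous hQ).1 (hfP.symm.trans hfQ)
  refine (hP.sign_mul hQ0).hasWeakDeriv ?_ ?_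
  · filter_upwards [coeFn_mulL signWeight f, coeFn_signWeight, hfP] with x h₁ h₂ h₃
    rw [h₁, h₂, h₃]
  · filter_upwards [coeFn_mulL signWeight g, coeFn_signWeight] with x h₁ h₂
    rw [h₁, h₂]

theorem two_mul_weightedInner_mulL_signWeight (k : ℝ≥0) :
    2 * weightedInner (expWeight k) (mulL signWeight f) g =
      k * weightedInner (expWeight k) f f := by
  have h_parts := (hasWeightDeriv_expWeight k).weightedInner_add (hfg.mulL_signWeight hf) hfg
  rw [weightedInner_dexpWeight, mulL_signWeight_mulL_signWeight, weightedInner_mulL_left _ g f,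
    weightedInner_comm _ g] at h_parts
  linarith

theorem weightedInner_sub_smul_mulL_signWeight (k : ℝ≥0) (c : ℝ) :
    weightedInner (expWeight k) (g - c • mulL signWeight f) (g - c • mulL signWeight f) =
      weightedInner (expWeight k) g g + (c ^ 2 - c * k) * weightedInner (expWeight k) f f := by
  simp only [map_sub, map_smul, sub_apply, smul_apply, smul_eq_mul,
    weightedInner_mulL_signWeight_self, weightedInner_comm _ g (mulL signWeight f)]
  linear_combination -c * hfg.two_mul_weightedInner_mulL_signWeight hf k

theorem hardy (k : ℝ≥0) :
    k ^ 2 / 4 * weightedInner (expWeight k) f f ≤ weightedInner (expWeight k) g g := by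
  have h_nonneg := weightedInner_self_nonneg (g - (k / 2 : ℝ) • mulL signWeight f)
    (expWeight_nonneg k)
  rw [hfg.weightedInner_sub_smul_mulL_signWeight hf] at h_nonneg
  linarith

end HasWeakDeriv

/-- The defect `u_x - (sign x) u / 2` in Hardy's inequality with the weight `exp (-|x|)`. -/
def hardyDefect (u : H1R) : L2R := dxL u - (1 / 2 : ℝ) • mulL signWeight (valL u)

/-- The quadratic form in `u` produced by the virial identity. -/
def virialForm (u : H1R) : ℝ := weightedInner (expWeight 1) (hardyDefect u) (hardyDefect u)

theorem virialForm_nonneg (u : H1R) : 0 ≤ virialForm u :=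
  weightedInner_self_nonneg _ (expWeight_nonneg 1)

namespace VanishesAtZero

variable {u : H1R} (hu : VanishesAtZero (valL u))
include hu

theorem two_mul_virialForm :
    2 * virialForm u = 2 * weightedInner (expWeight 1) (dxL u) (dxL u)
      + weightedInner (dexpWeight 1) (valL u) (dxL u) := by
  have h_cross := (hasWeakDeriv_valL u).two_mul_weightedInner_mulL_signWeight hu 1
  rw [virialForm, hardyDefect, (hasWeakDeriv_valL u).weightedInner_sub_smul_mulL_signWeight hu,
    weightedInner_dexpWeight]
  rw [NNReal.coe_one] at *
  linarith

theorem weightedInner_dxL_le :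
    weightedInner (expWeight 2) (dxL u) (dxL u) ≤ 4 * virialForm u := by
  have h_hardy := (hasWeakDeriv_valL u).hardy hu 2
  have h_defect : weightedInner (expWeight 2) (hardyDefect u) (hardyDefect u) ≤ virialForm u :=
    weightedInner_self_mono _ (expWeight_anti one_le_two)
  rw [hardyDefect, (hasWeakDeriv_valL u).weightedInner_sub_smul_mulL_signWeight hu] at h_defect
  rw [NNReal.coe_ofNat] at *
  linarith

theorem weightedInner_valL_le :
    weightedInner (expWeight 2) (valL u) (valL u) ≤ 4 * virialForm u := by
  have h_hardy := (hasWeakDeriv_valL u).hardy hu 2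
  rw [NNReal.coe_ofNat] at h_hardy
  linarith [hu.weightedInner_dxL_le]

/-- Hardy's inequality for `q = u²`, in the form `‖q‖ ≤ 2 ‖q_x - (sign x) q‖`, gains a factor
`‖u‖²` because `q_x - (sign x) q = 2 u (u_x - (sign x) u / 2)`. -/
theorem weightedInner_sqH1_le :
    weightedInner (expWeight 1) (sqH1 u) (sqH1 u) ≤ 16 * ‖u‖ ^ 2 * virialForm u := by
  have h_weak := hasWeakDeriv_sqH1 u
  have h_hardy := h_weak.hardy (vanishesAtZero_sqH1 hu) 1
  have h_defect : sqDx u - (1 : ℝ) • mulL signWeight (sqH1 u) =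
      (2 : ℝ) • mulL (supL u) (hardyDefect u) := by
    rw [sqDx, hardyDefect, sqH1, mulL_left_comm signWeight, map_sub, map_smul]
    module
  have h_defect_sq := h_weak.weightedInner_sub_smul_mulL_signWeight (vanishesAtZero_sqH1 hu) 1 1
  have h_sup : weightedInner (expWeight 1) (mulL (supL u) (hardyDefect u))
      (mulL (supL u) (hardyDefect u)) ≤ ‖u‖ ^ 2 * virialForm u :=
    (weightedInner_mulL_self_le _ (expWeight_nonneg 1) (supL u)).trans <|
      mul_le_mul_of_nonneg_right (by gcongr; exact norm_supL_le u) (virialForm_nonneg u)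
  rw [h_defect] at h_defect_sq
  simp only [map_smul, smul_apply, smul_eq_mul] at h_defect_sq
  rw [NNReal.coe_one] at *
  linarith

end VanishesAtZero

/-! ### A variant of Barbalat's lemma -/

theorem monotoneOn_Ici_of_hasDerivWithinAt {Φ Φ' : ℝ → ℝ} {a : ℝ}
    (h : ∀ t, a ≤ t → HasDerivWithinAt Φ (Φ' t) (Ici a) t) (h0 : ∀ t, a ≤ t → 0 ≤ Φ' t) :
    MonotoneOn Φ (Ici a) :=
  monotoneOn_of_hasDerivWithinAt_nonneg (convex_Ici a) (fun t ht => (h t ht).continuousWithinAt)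
    (fun t ht => (h t (interior_subset ht)).mono interior_subset)
    fun t ht => h0 t (interior_subset ht)

theorem exists_tendsto_of_hasDerivWithinAt_nonneg {Φ Φ' : ℝ → ℝ} {a K : ℝ}
    (h : ∀ t, a ≤ t → HasDerivWithinAt Φ (Φ' t) (Ici a) t) (h0 : ∀ t, a ≤ t → 0 ≤ Φ' t)
    (hK : ∀ t, a ≤ t → Φ t ≤ K) : ∃ l, Tendsto Φ atTop (𝓝 l) := by
  have h_mono : Monotone fun t => Φ (max t a) := fun s t hst =>
    monotoneOn_Ici_of_hasDerivWithinAt h h0 (mem_Ici.2 (le_max_right _ _))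
      (mem_Ici.2 (le_max_right _ _)) (max_le_max_right a hst)
  have h_bdd : BddAbove (range fun t => Φ (max t a)) :=
    ⟨K, by rintro _ ⟨t, rfl⟩; exact hK _ (le_max_right _ _)⟩
  refine ⟨_, (tendsto_atTop_ciSup h_mono h_bdd).congr' ?_⟩
  filter_upwards [eventually_ge_atTop a] with t ht
  rw [max_eq_left ht]

theorem nonpos_of_tendsto_of_le_deriv {f Φ Φ' : ℝ → ℝ} {a k K : ℝ} (hf : Tendsto f atTop (𝓝 k))
    (hΦ : ∀ t, a ≤ t → HasDerivWithinAt Φ (Φ' t) (Ici a) t) (hle : ∀ t, a ≤ t → f t ≤ Φ' t)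
    (hK : ∀ t, a ≤ t → Φ t ≤ K) : k ≤ 0 := by
  by_contra! hk
  obtain ⟨T, hT, haT⟩ : ∃ T, (∀ t, T ≤ t → k / 2 < f t) ∧ a ≤ T := by
    obtain ⟨T, hT⟩ := eventually_atTop.1 (hf.eventually (lt_mem_nhds (half_lt_self hk)))
    exact ⟨max T a, fun t ht => hT t (le_of_max_le_left ht), le_max_right T a⟩
  have h_mono : MonotoneOn (fun t => Φ t - k / 2 * t) (Ici T) :=
    monotoneOn_Ici_of_hasDerivWithinAt
      (fun t ht => ((hΦ t (haT.trans ht)).mono (Ici_subset_Ici.2 haT)).sub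
        ((hasDerivWithinAt_id t _).const_mul (k / 2)))
      fun t ht => by linarith [hle t (haT.trans ht), hT t ht]
  obtain ⟨t, hKt, hTt⟩ := (((tendsto_id.const_mul_atTop (half_pos hk)).eventually_gt_atTop
    (K - (Φ T - k / 2 * T))).and (eventually_ge_atTop T)).exists
  have h_growth : Φ T - k / 2 * T ≤ Φ t - k / 2 * t := h_mono self_mem_Ici hTt hTt
  rw [id_eq] at hKt
  linarith [hK t (haT.trans hTt)]

theorem tendsto_zero_of_le_deriv {f f' Φ Φ' : ℝ → ℝ} {a L K : ℝ} (h0 : ∀ t, a ≤ t → 0 ≤ f t)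
    (hf : ∀ t, a ≤ t → HasDerivWithinAt f (f' t) (Ici a) t) (hL : ∀ t, a ≤ t → |f' t| ≤ L)
    (hΦ : ∀ t, a ≤ t → HasDerivWithinAt Φ (Φ' t) (Ici a) t) (hle : ∀ t, a ≤ t → f t ≤ Φ' t)
    (hK : ∀ t, a ≤ t → Φ t ≤ K) : Tendsto f atTop (𝓝 0) := by
  have hL0 : 0 ≤ L := (abs_nonneg _).trans (hL a le_rfl)
  obtain ⟨l, hl⟩ := exists_tendsto_of_hasDerivWithinAt_nonneg hΦ
    (fun t ht => (h0 t ht).trans (hle t ht)) hK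
  -- `f f' ≤ L f ≤ L Φ'`, so `2 L Φ - f²` is also monotone and bounded above: `f²` converges.
  obtain ⟨m, hm⟩ := exists_tendsto_of_hasDerivWithinAt_nonneg (K := 2 * L * K)
    (fun t ht => ((hΦ t ht).const_mul (2 * L)).sub ((hf t ht).mul (hf t ht)))
    (fun t ht => by
      have h_mul := mul_le_mul_of_nonneg_left ((le_abs_self _).trans (hL t ht)) (h0 t ht)
      have h_le := mul_le_mul_of_nonneg_left (hle t ht) hL0
      linarith)
    (fun t ht => by
      have h_le := mul_le_mul_of_nonneg_left (hK t ht) hL0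
      simp only [Pi.sub_apply, Pi.mul_apply]
      linarith [mul_self_nonneg (f t)])
  have h_sq : Tendsto (fun t => f t * f t) atTop (𝓝 (2 * L * l - m)) :=
    ((hl.const_mul (2 * L)).sub hm).congr fun t => by simp
  have h_lim : Tendsto f atTop (𝓝 √(2 * L * l - m)) := by
    refine h_sq.sqrt.congr' ?_
    filter_upwards [eventually_ge_atTop a] with t ht
    exact Real.sqrt_mul_self (h0 t ht)
  have h_zero := (nonpos_of_tendsto_of_le_deriv h_lim hΦ hle hK).antisymm (Real.sqrt_nonneg _)
  rwa [h_zero] at h_lim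

/-! ### Decay of the localized energy -/

theorem abs_weightedInner_le_of_norm_le {B : ℝ} (a : LinftyR) {f g : L2R} (hf : ‖f‖ ≤ B)
    (hg : ‖g‖ ≤ B) : |weightedInner a f g| ≤ ‖a‖ * B ^ 2 :=
  calc |weightedInner a f g| ≤ ‖a‖ * ‖f‖ * ‖g‖ := abs_weightedInner_le a f g
    _ ≤ ‖a‖ * B * B := by have := (norm_nonneg f).trans hf; gcongr
    _ = ‖a‖ * B ^ 2 := by ring

theorem abs_weightedInner_le_quarter_add {a : LinftyR} (ha : 0 ≤ a) (f g : L2R) :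
    |weightedInner a f g| ≤ weightedInner a f f / 4 + weightedInner a g g := by
  have h_scaled := two_mul_abs_weightedInner_le f ((2 : ℝ) • g) ha
  simp only [map_smul, smul_apply, smul_eq_mul, abs_mul, abs_two] at h_scaled
  linarith

theorem norm_sqH1_le (u : H1R) : ‖sqH1 u‖ ≤ ‖u‖ ^ 2 :=
  calc ‖sqH1 u‖ ≤ ‖supL u‖ * ‖valL u‖ := norm_mulL_le _ _
    _ ≤ ‖u‖ * ‖u‖ := mul_le_mul (norm_supL_le u) (norm_valL_le u) (norm_nonneg _) (norm_nonneg _)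
    _ = ‖u‖ ^ 2 := (sq _).symm

/-- The squared norm of a state in `H¹ × L² × L² × L²`, localized by the weight `a`. -/
def weightedNormSq (a : LinftyR) (u : H1R) (w n v : L2R) : ℝ :=
  weightedInner a (valL u) (valL u) + weightedInner a (dxL u) (dxL u) + weightedInner a w w
    + weightedInner a n n + weightedInner a v v

theorem weightedNormSq_nonneg {a : LinftyR} (ha : 0 ≤ a) (u : H1R) (w n v : L2R) :
    0 ≤ weightedNormSq a u w n v := by
  have h_nonneg (f : L2R) : 0 ≤ weightedInner a f f := weightedInner_self_nonneg f ha
  unfold weightedNormSq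
  linarith [h_nonneg (valL u), h_nonneg (dxL u), h_nonneg w, h_nonneg n, h_nonneg v]

theorem weightedNormSq_le {a : LinftyR} (ha : 0 ≤ a) {u : H1R} (hu : ‖u‖ ≤ 1 / 2) (w n v : L2R) :
    weightedNormSq a u w n v ≤ 4 * weightedEnergy a u w n v := by
  have h_nonneg (f : L2R) : 0 ≤ weightedInner a f f := weightedInner_self_nonneg f ha
  have h_cubic := neg_le_of_abs_le (abs_weightedInner_le_quarter_add ha n (sqH1 u))
  have h_quartic : weightedInner a (sqH1 u) (sqH1 u) ≤ (1 / 2) ^ 2 * weightedInner a (valL u)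
      (valL u) :=
    (weightedInner_mulL_self_le _ ha (supL u)).trans <|
      mul_le_mul_of_nonneg_right (by gcongr; exact (norm_supL_le u).trans hu) (h_nonneg _)
  unfold weightedNormSq weightedEnergy
  linarith [h_nonneg (valL u), h_nonneg (dxL u), h_nonneg w, h_nonneg v]

/-- The momentum with the odd weight `virialWeight`, corrected by `∫ exp (-|x|) u u_t`: its
derivative controls the terms with `n` and `v` and, by Hardy's inequality, `u` and `u_x`, but not
`u_t`. -/
def virial (u : H1R) (w n v : L2R) : ℝ :=
  weightedMomentum virialWeight u w n v + weightedInner (expWeight 1) (valL u) w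

theorem VanishesAtZero.weightedInner_sqH1_le_virialForm {u : H1R} (hu0 : VanishesAtZero (valL u))
    (hu : ‖u‖ ≤ 1 / 4) :
    weightedInner (expWeight 1) (sqH1 u) (sqH1 u) ≤ virialForm u :=
  calc weightedInner (expWeight 1) (sqH1 u) (sqH1 u)
    _ ≤ 16 * ‖u‖ ^ 2 * virialForm u := hu0.weightedInner_sqH1_le
    _ ≤ 16 * (1 / 4) ^ 2 * virialForm u := by have := virialForm_nonneg u; gcongr
    _ = virialForm u := by ring

namespace IsContinuousKGZSolution

variable {u : ℝ → H1R} {w n v : ℝ → L2R} (H : IsContinuousKGZSolution u w n v)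
include H

theorem hasDerivWithinAt_virial {t : ℝ} (ht : 0 ≤ t) (hu : VanishesAtZero (valL (u t))) :
    HasDerivWithinAt (fun s => virial (u s) (w s) (n s) (v s))
      (-(2 * virialForm (u t)
        + (weightedInner (expWeight 1) (n t) (n t) + weightedInner (expWeight 1) (v t) (v t)) / 2
        + weightedInner (expWeight 1) (n t) (sqH1 (u t)))) (Ici 0) t := by
  convert! (H.hasDerivWithinAt_weightedMomentum hasWeightDeriv_virialWeight ht).add
    (H.hasDerivWithinAt_weightedInner_val_w (hasWeightDeriv_expWeight 1) ht) using 1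
  rw [hu.two_mul_virialForm]
  ring

theorem weightedEnergy_expWeight_zero_eq {t : ℝ} (ht : 0 ≤ t) :
    weightedEnergy (expWeight 0) (u t) (w t) (n t) (v t) =
      weightedEnergy (expWeight 0) (u 0) (w 0) (n 0) (v 0) := by
  let E (s : ℝ) : ℝ := weightedEnergy (expWeight 0) (u s) (w s) (n s) (v s)
  have h_deriv (s : ℝ) (hs : 0 ≤ s) : HasDerivWithinAt E 0 (Ici 0) s := by
    simpa [E, dexpWeight_zero, weightedInner_eq_inner] using
      H.hasDerivWithinAt_weightedEnergy (hasWeightDeriv_expWeight 0) hs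
  exact constant_of_has_deriv_right_zero (f := E)
    (fun s hs => (h_deriv s hs.1).continuousWithinAt.mono Icc_subset_Ici_self)
    (fun s hs => (h_deriv s hs.1).mono (Ici_subset_Ici.2 hs.1)) t ⟨ht, le_rfl⟩

theorem exists_norm_le (hu : ∀ t, 0 ≤ t → ‖u t‖ ≤ 1 / 2) :
    ∃ B : ℝ, ∀ t, 0 ≤ t → ‖u t‖ ≤ B ∧ ‖w t‖ ≤ B ∧ ‖n t‖ ≤ B ∧ ‖v t‖ ≤ B := by
  refine ⟨√(4 * weightedEnergy (expWeight 0) (u 0) (w 0) (n 0) (v 0)), fun t ht => ?_⟩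
  have h_energy := weightedNormSq_le (expWeight_nonneg 0) (hu t ht) (w t) (n t) (v t)
  rw [H.weightedEnergy_expWeight_zero_eq ht] at h_energy
  have h_norm : weightedNormSq (expWeight 0) (u t) (w t) (n t) (v t) =
      ‖u t‖ ^ 2 + ‖w t‖ ^ 2 + ‖n t‖ ^ 2 + ‖v t‖ ^ 2 := by
    simp only [weightedNormSq, weightedInner_expWeight_zero, real_inner_self_eq_norm_sq,
      H1R.norm_sq_eq]
  rw [h_norm] at h_energy
  refine ⟨?_, ?_, ?_, ?_⟩ <;> refine Real.le_sqrt_of_sq_le ?_ <;>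
    linarith [sq_nonneg ‖u t‖, sq_nonneg ‖w t‖, sq_nonneg ‖n t‖, sq_nonneg ‖v t‖]

end IsContinuousKGZSolution

/-- The functional whose derivative dominates the energy localized by `exp (-2 |x|)`: its first term
recovers `∫ exp (-2 |x|) u_t²`, which is missing in the derivative of `virial`. -/
def decayFunctional (u : H1R) (w n v : L2R) : ℝ :=
  weightedInner (expWeight 2) (valL u) w - 26 * virial u w n v

theorem decayFunctional_le {B : ℝ} {u : H1R} {w n v : L2R} (hu : ‖u‖ ≤ B) (hw : ‖w‖ ≤ B)
    (hn : ‖n‖ ≤ B) (hv : ‖v‖ ≤ B) :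
    decayFunctional u w n v ≤
      (‖expWeight 2‖ + 26 * (3 * ‖virialWeight‖ + ‖expWeight 1‖)) * B ^ 2 := by
  have h_uw (a : LinftyR) := abs_le.1
    (abs_weightedInner_le_of_norm_le a ((norm_valL_le u).trans hu) hw)
  have h_dw := abs_le.1
    (abs_weightedInner_le_of_norm_le virialWeight ((norm_dxL_le u).trans hu) hw)
  have h_nv := abs_le.1 (abs_weightedInner_le_of_norm_le virialWeight hn hv)
  unfold decayFunctional virial weightedMomentum
  linarith [h_uw (expWeight 1), h_uw (expWeight 2)]

namespace IsContinuousKGZSolution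

variable {u : ℝ → H1R} {w n v : ℝ → L2R} (H : IsContinuousKGZSolution u w n v)
include H

theorem exists_hasDerivWithinAt_decayFunctional {t : ℝ} (ht : 0 ≤ t)
    (hu0 : VanishesAtZero (valL (u t))) (hu : ‖u t‖ ≤ 1 / 4) :
    ∃ d, HasDerivWithinAt (fun s => decayFunctional (u s) (w s) (n s) (v s)) d (Ici 0) t ∧
      weightedEnergy (expWeight 2) (u t) (w t) (n t) (v t) ≤ d := by
  refine ⟨_, (H.hasDerivWithinAt_weightedInner_val_w (hasWeightDeriv_expWeight 2) ht).sub
    ((H.hasDerivWithinAt_virial ht hu0).const_mul 26), ?_⟩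
  have h_cross : |weightedInner (dexpWeight 2) (valL (u t)) (dxL (u t))| ≤
      weightedInner (expWeight 2) (valL (u t)) (valL (u t))
        + weightedInner (expWeight 2) (dxL (u t)) (dxL (u t)) := by
    rw [weightedInner_dexpWeight, NNReal.coe_ofNat, abs_mul, abs_neg, abs_two,
      ← weightedInner_mulL_signWeight_self _ (valL (u t))]
    exact two_mul_abs_weightedInner_le _ _ (expWeight_nonneg 2)
  have h_nq (k : ℝ≥0) := abs_le.1
    (abs_weightedInner_le_quarter_add (expWeight_nonneg k) (n t) (sqH1 (u t)))
  have h_anti (f : L2R) : weightedInner (expWeight 2) f f ≤ weightedInner (expWeight 1) f f :=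
    weightedInner_self_mono f (expWeight_anti one_le_two)
  have h_nonneg (f : L2R) : 0 ≤ weightedInner (expWeight 1) f f :=
    weightedInner_self_nonneg f (expWeight_nonneg 1)
  unfold weightedEnergy
  linarith [abs_le.1 h_cross, h_nq 1, h_nq 2, h_anti (n t), h_anti (v t), h_anti (sqH1 (u t)),
    h_nonneg (n t), h_nonneg (v t), hu0.weightedInner_valL_le, hu0.weightedInner_dxL_le,
    hu0.weightedInner_sqH1_le_virialForm hu]

theorem tendsto_weightedEnergy (hu0 : ∀ t, 0 ≤ t → VanishesAtZero (valL (u t)))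
    (hu : ∀ t, 0 ≤ t → ‖u t‖ ≤ 1 / 4) :
    Tendsto (fun t => weightedEnergy (expWeight 2) (u t) (w t) (n t) (v t)) atTop (𝓝 0) := by
  have hu_half (t : ℝ) (ht : 0 ≤ t) : ‖u t‖ ≤ 1 / 2 := (hu t ht).trans (by norm_num)
  obtain ⟨B, hB⟩ := H.exists_norm_le hu_half
  choose! d hd h_le using fun t ht =>
    H.exists_hasDerivWithinAt_decayFunctional ht (hu0 t ht) (hu t ht)
  refine tendsto_zero_of_le_deriv (L := 4 * (‖dexpWeight 2‖ * B ^ 2))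
    (K := (‖expWeight 2‖ + 26 * (3 * ‖virialWeight‖ + ‖expWeight 1‖)) * B ^ 2) (fun t ht => ?_)
    (fun t ht => H.hasDerivWithinAt_weightedEnergy (hasWeightDeriv_expWeight 2) ht)
    (fun t ht => ?_) hd h_le fun t ht => ?_
  · linarith [weightedNormSq_nonneg (expWeight_nonneg 2) (u t) (w t) (n t) (v t),
      weightedNormSq_le (expWeight_nonneg 2) (hu_half t ht) (w t) (n t) (v t)]
  · obtain ⟨huB, hwB, hnB, hvB⟩ := hB t ht
    have hqB : ‖sqH1 (u t)‖ ≤ B := (norm_sqH1_le _).trans <|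
      (pow_le_of_le_one (norm_nonneg _) ((hu t ht).trans (by norm_num)) two_ne_zero).trans huB
    have h_dw := abs_le.1
      (abs_weightedInner_le_of_norm_le (dexpWeight 2) ((norm_dxL_le (u t)).trans huB) hwB)
    have h_nv := abs_le.1 (abs_weightedInner_le_of_norm_le (dexpWeight 2) hnB hvB)
    have h_vq := abs_le.1 (abs_weightedInner_le_of_norm_le (dexpWeight 2) hvB hqB)
    rw [abs_le]
    constructor <;> linarith
  · obtain ⟨huB, hwB, hnB, hvB⟩ := hB t ht
    exact decayFunctional_le huB hwB hnB hvB

end IsContinuousKGZSolution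

/-! ### Local norms -/

theorem setIntegral_Icc_sq_le (a b : ℝ) (f : L2R) (k : ℝ≥0) :
    ∫ x in Icc a b, f x ^ 2 ≤
      Real.exp (k * (|a| + |b|)) * weightedInner (expWeight k) f f := by
  have h_int := (integrable_weight_mul (expWeight k) f f).const_mul (Real.exp (k * (|a| + |b|)))
  have h_sq : Integrable fun x => f x ^ 2 := by simpa only [sq] using L2R.integrable_mul f f
  rw [weightedInner_apply, ← integral_const_mul]
  calc ∫ x in Icc a b, f x ^ 2
    _ ≤ ∫ x in Icc a b, Real.exp (k * (|a| + |b|)) * (expWeight k x * f x * f x) := by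
      refine setIntegral_mono_on_ae h_sq.integrableOn h_int.integrableOn measurableSet_Icc ?_
      filter_upwards [coeFn_expWeight k] with x hx hxI
      have h_abs : |x| ≤ |a| + |b| :=
        (abs_le_max_abs_abs hxI.1 hxI.2).trans (max_le_add_of_nonneg (abs_nonneg a) (abs_nonneg b))
      rw [hx, mul_assoc, ← mul_assoc, ← Real.exp_add, ← sq]
      refine le_mul_of_one_le_left (sq_nonneg _) (Real.one_le_exp ?_)
      linarith [mul_le_mul_of_nonneg_left h_abs k.coe_nonneg]
    _ ≤ ∫ x, Real.exp (k * (|a| + |b|)) * (expWeight k x * f x * f x) := by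
      refine setIntegral_le_integral h_int ?_
      filter_upwards [coeFn_expWeight k] with x hx
      rw [hx, mul_assoc, Pi.zero_apply]
      have := mul_self_nonneg (f x)
      positivity

theorem localNorm_le (a b : ℝ) (k : ℝ≥0) (u : H1R) (w n v : L2R) :
    normH1On a b u + normL2On a b w + normL2On a b n + normL2On a b v ≤
      4 * √(Real.exp (k * (|a| + |b|)) * weightedNormSq (expWeight k) u w n v) := by
  have h_Icc (f : L2R) := setIntegral_Icc_sq_le a b f k
  have h_nonneg (f : L2R) : 0 ≤ Real.exp (k * (|a| + |b|)) * weightedInner (expWeight k) f f :=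
    mul_nonneg (Real.exp_nonneg _) (weightedInner_self_nonneg f (expWeight_nonneg k))
  have h_int (f : L2R) : IntegrableOn (fun x => f x ^ 2) (Icc a b) := by
    simpa only [sq] using (L2R.integrable_mul f f).integrableOn
  set C := Real.exp (k * (|a| + |b|))
  set R := C * weightedNormSq (expWeight k) u w n v
  have hR : R = C * weightedInner (expWeight k) (valL u) (valL u)
      + C * weightedInner (expWeight k) (dxL u) (dxL u) + C * weightedInner (expWeight k) w w
      + C * weightedInner (expWeight k) n n + C * weightedInner (expWeight k) v v := by
    simp only [R, weightedNormSq]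
    ring
  have h_u : normH1On a b u ≤ √R := Real.sqrt_le_sqrt <|
    calc ∫ x in Icc a b, (valL u x ^ 2 + dxL u x ^ 2)
      _ = (∫ x in Icc a b, valL u x ^ 2) + ∫ x in Icc a b, dxL u x ^ 2 :=
        integral_add (h_int _) (h_int _)
      _ ≤ R := by linarith [h_Icc (valL u), h_Icc (dxL u), h_nonneg w, h_nonneg n, h_nonneg v]
  have h_L2 {f : L2R} (hf : C * weightedInner (expWeight k) f f ≤ R) : normL2On a b f ≤ √R :=
    Real.sqrt_le_sqrt ((h_Icc f).trans hf)
  have h_H1_nonneg := add_nonneg (h_nonneg (valL u)) (h_nonneg (dxL u))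
  have h_w : normL2On a b w ≤ √R := h_L2 (by linarith [h_nonneg n, h_nonneg v])
  have h_n : normL2On a b n ≤ √R := h_L2 (by linarith [h_nonneg w, h_nonneg v])
  have h_v : normL2On a b v ≤ √R := h_L2 (by linarith [h_nonneg w, h_nonneg n])
  linarith

theorem theorem3_general {u : ℝ → H1R} {w n v : ℝ → L2R} (H : IsKGZSolution u w n v)
    (hu0 : ∀ t, 0 ≤ t → VanishesAtZero (l2Val (u t))) (hu : ∀ t, 0 ≤ t → ‖u t‖ ≤ 1 / 4) (a b : ℝ) :
    Tendsto (fun t => normH1On a b (u t) + normL2On a b (w t) + normL2On a b (n t)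
      + normL2On a b (v t)) atTop (𝓝 0) := by
  let E (t : ℝ) : ℝ := weightedEnergy (expWeight 2) (u t) (w t) (n t) (v t)
  have h_energy : Tendsto E atTop (𝓝 0) := by
    refine (H.comp_max_zero.tendsto_weightedEnergy (fun t _ => hu0 _ (le_max_right t 0))
      fun t _ => hu _ (le_max_right t 0)).congr' ?_
    filter_upwards [eventually_ge_atTop 0] with t ht
    rw [max_eq_left ht]
  have h_local : ∀ᶠ t in atTop, normH1On a b (u t) + normL2On a b (w t) + normL2On a b (n t)
      + normL2On a b (v t) ≤ 4 * √(Real.exp (2 * (|a| + |b|)) * (4 * E t)) := by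
    filter_upwards [eventually_ge_atTop 0] with t ht
    refine (localNorm_le a b 2 (u t) (w t) (n t) (v t)).trans ?_
    rw [NNReal.coe_ofNat]
    gcongr
    exact weightedNormSq_le (expWeight_nonneg 2) ((hu t ht).trans (by norm_num)) _ _ _
  refine squeeze_zero' (.of_forall fun t => ?_) h_local ?_
  · unfold normH1On normL2On
    positivity
  · simpa using ((h_energy.const_mul 4).const_mul (Real.exp (2 * (|a| + |b|)))).sqrt.const_mul 4

end

theorem theorem3 :
    ∃ ε : ℝ, 0 < ε ∧
      ∀ (u : ℝ → H1R) (w n v : ℝ → L2R),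
        IsKGZSolution u w n v →
        (∀ t : ℝ, 0 ≤ t → IsOddL2 (l2Val (u t))) →
        (∀ t : ℝ, 0 ≤ t → ‖u t‖ ≤ ε) →
        (∃ C : ℝ, ∀ t : ℝ, 0 ≤ t → ‖w t‖ ≤ C) →
        ∀ a b : ℝ,
          Tendsto
            (fun t : ℝ =>
              normH1On a b (u t) + normL2On a b (w t) + normL2On a b (n t) + normL2On a b (v t))
            atTop (𝓝 0) :=
  ⟨1 / 4, by norm_num, fun _ _ _ _ H h_odd hu _ => theorem3_general H
    (fun t ht => (h_odd t ht).vanishesAtZero (hasWeakDeriv_valL _)) hu⟩
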